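/- Let $I_\theta=[0,2\pi]$, $I_z=[-\tfrac12,\tfrac12]$ and $\Omega=I_\theta\times I_z$, with coordinates $(\theta,z)$. Let $H^k_{\mathrm{per}}(\Omega)$ denote the space of periodic $L^2$-Sobolev functions of order $k$ on $\Omega$ ($2\pi$-periodic in $\theta$, $1$-periodic in $z$). For a displacement $\phi=(\phi_\rho,\phi_\theta,\phi_z):\Omega\to\mathbb R^3$ and $h>0$, the free-shear functional is $$FS_h(\phi)=\int_\Omega |\epsilon_{\theta\theta}|^2+|\epsilon_{zz}|^2+h^2|D^2\phi_\rho|^2\,d\theta\,dz,\qquad \epsilon_{\theta\theta}=\partial_\theta\phi_\theta+\tfrac12(\partial_\theta\phi_\rho)^2+\phi_\rho,\quad \epsilon_{zz}=\partial_z\phi_z+\tfrac12(\partial_z\phi_\rho)^2 .$$ For $\lambda\in(0,1)$ let $$A_{\lambda,\infty}=\{\phi:\Omega\to\mathbb R^3 \;:\; \phi_\rho\in H^2_{\mathrm{per}}(\Omega),\ \phi_\theta\in H^1_{\mathrm{per}}(\Omega),\ \phi_z+\lambda z\in H^1_{\mathrm{per}}(\Omega),\ \phi_\rho\ge 0 \text{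 a.e.}\}$$ (the admissible set for the neutral mandrel, with no bound on the slopes). There is a numerical constant $C>0$ with the following property. Let $(h_\alpha,\lambda_\alpha)_{\alpha>0}$ be any family with $h_\alpha,\lambda_\alpha\in(0,\tfrac12]$ and $h_\alpha/\lambda_\alpha^{5/6}\to0$ as $\alpha\to\infty$, and let $(\phi^\alpha)_{\alpha>0}$ be any family of minimizers, i.e. $\phi^\alpha\in A_{\lambda_\alpha,\infty}$ and $FS_{h_\alpha}(\phi^\alpha)=\min_{A_{\lambda_\alpha,\infty}}FS_{h_\alpha}$ for all $\alpha>0$. Then, for all sufficiently large $\alpha$, $$h_\alpha^{-1/11}\lambda_\alpha^{9/22}\le C\,\|D\phi^\alpha_\rho\|_{L^\infty(\Omega)},$$ where the right-hand side may be $+\infty$. -/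

import Mathlib

open MeasureTheory Set Filter Asymptotics
open scoped ENNReal ContDiff

noncomputable section

namespace FreeShear

/-- The reference domain `Ω = [0, 2π] × [-1/2, 1/2]`, with coordinates `(θ, z)`.
Functions on `Ω` are represented by functions on `ℝ × ℝ` whose values off `Ω` are never used. -/
def Omega : Set (ℝ × ℝ) := Icc 0 (2 * Real.pi) ×ˢ Icc (-1 / 2) (1 / 2)

/-- Lebesgue measure `dθ dz` on `Ω`. -/
def vol : Measure (ℝ × ℝ) := volume.restrict Omega

/-- The coordinate directions: `dir 0 = e_θ` and `dir 1 = e_z`. -/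
def dir : Fin 2 → ℝ × ℝ := ![(1, 0), (0, 1)]

/-- `g` is the weak partial derivative `∂_i f` of `f` in the interior of `Ω`. -/
def HasWeakDeriv (i : Fin 2) (f g : ℝ × ℝ → ℝ) : Prop :=
  LocallyIntegrableOn f (interior Omega) ∧ LocallyIntegrableOn g (interior Omega) ∧
    ∀ ψ : ℝ × ℝ → ℝ, ContDiff ℝ ∞ ψ → HasCompactSupport ψ → tsupport ψ ⊆ interior Omega →
      ∫ x, f x * fderiv ℝ ψ x (dir i) ∂vol = -∫ x, g x * ψ x ∂vol

/-- Weak derivatives are unique almost everywhere on `Ω`. -/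
theorem HasWeakDeriv.ae_unique {i : Fin 2} {f g g' : ℝ × ℝ → ℝ}
    (hg : HasWeakDeriv i f g) (hg' : HasWeakDeriv i f g') : g =ᵐ[vol] g' := by
  have hmeas : vol = volume.restrict (interior Omega) :=
    (Measure.restrict_congr_set (interior_ae_eq_of_null_frontier
      (((convex_Icc 0 (2 * Real.pi)).prod (convex_Icc (-1 / 2) (1 / 2))).addHaar_frontier
        volume))).symm
  have hint : ∀ {u : ℝ × ℝ → ℝ} {ψ : ℝ × ℝ → ℝ}, LocallyIntegrableOn u (interior Omega) →
      ContDiff ℝ ∞ ψ → HasCompactSupport ψ → tsupport ψ ⊆ interior Omega →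
      Integrable (fun x => u x * ψ x) vol := by
    intro u ψ hu hψ hc hs
    have h1 : IntegrableOn (fun x => u x * ψ x) (tsupport ψ) :=
      (hu.integrableOn_compact_subset hs hc).mul_continuousOn hψ.continuous.continuousOn hc
    have h2 : Integrable (fun x => u x * ψ x) := by
      rwa [integrableOn_iff_integrable_of_support_subset] at h1
      exact (Function.support_mul_subset_right u ψ).trans (subset_tsupport ψ)
    exact h2.restrict
  have key := isOpen_interior.ae_eq_zero_of_integral_contDiff_smul_eq_zero
    (hg.2.1.sub hg'.2.1) (fun ψ hψ hc hs => by
      have h1 := hg.2.2 ψ hψ hc hs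
      rw [hg'.2.2 ψ hψ hc hs, neg_inj] at h1
      have h2 : ∫ x, (g x * ψ x - g' x * ψ x) ∂vol = 0 := by
        rw [integral_sub (hint hg.2.1 hψ hc hs) (hint hg'.2.1 hψ hc hs), h1, sub_self]
      rw [hmeas, setIntegral_eq_integral_of_forall_compl_eq_zero] at h2
      · rw [← h2]
        congr 1
        ext x
        simp only [Pi.sub_apply, smul_eq_mul]
        ring
      · intro x hx
        simp [image_eq_zero_of_notMem_tsupport fun h => hx (hs h)])
  rw [hmeas]
  filter_upwards [ae_restrict_of_ae key, ae_restrict_mem isOpen_interior.measurableSet]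
    with x hx hxU
  exact sub_eq_zero.1 (hx hxU)

open Classical in
/-- The weak partial derivative `∂_i f` (unique up to null sets of `Ω`), where it exists;
`0` otherwise. -/
def wd (i : Fin 2) (f : ℝ × ℝ → ℝ) : ℝ × ℝ → ℝ :=
  if h : ∃ g, HasWeakDeriv i f g then h.choose else 0

/-- The Sobolev space `H¹(Ω)`. -/
structure MemH1 (f : ℝ × ℝ → ℝ) : Prop where
  memLp : MemLp f 2 vol
  hasWeakDeriv : ∀ i, HasWeakDeriv i f (wd i f)
  memLp_wd : ∀ i, MemLp (wd i f) 2 vol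

/-- Smooth functions of the plane which are `2π`-periodic in `θ` and `1`-periodic in `z`. -/
structure IsPeriodicTest (ψ : ℝ × ℝ → ℝ) : Prop where
  smooth : ContDiff ℝ ∞ ψ
  periodic_theta : ∀ θ z, ψ (θ + 2 * Real.pi, z) = ψ (θ, z)
  periodic_z : ∀ θ z, ψ (θ, z + 1) = ψ (θ, z)

/-- The periodic Sobolev space `H¹_per(Ω)`: the functions in `H¹(Ω)` whose weak derivatives are
those on the torus obtained by gluing opposite sides of `Ω`, i.e. for which integration by parts
against smooth periodic functions produces no boundary term. -/
structure MemH1per (f : ℝ × ℝ → ℝ) : Prop where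
  memH1 : MemH1 f
  periodic : ∀ i ψ, IsPeriodicTest ψ →
    ∫ x, f x * fderiv ℝ ψ x (dir i) ∂vol = -∫ x, wd i f x * ψ x ∂vol

/-- The periodic Sobolev space `H²_per(Ω)`. -/
structure MemH2per (f : ℝ × ℝ → ℝ) : Prop where
  memH1per : MemH1per f
  wd_memH1per : ∀ i, MemH1per (wd i f)

/-- A displacement field `φ : Ω → ℝ³` in cylindrical coordinates: `rad = φ_ρ`,
`cyl 0 = φ_θ` and `cyl 1 = φ_z`. -/
structure Displacement where
  rad : ℝ × ℝ → ℝ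
  cyl : Fin 2 → ℝ × ℝ → ℝ

/-- The gradient `Df = (∂_θ f, ∂_z f)`, with values in the Euclidean plane. -/
def grad (f : ℝ × ℝ → ℝ) (x : ℝ × ℝ) : EuclideanSpace ℝ (Fin 2) :=
  WithLp.toLp 2 fun i => wd i f x

/-- The squared Euclidean norm `|D²f|²` of the Hessian. -/
def hessSq (f : ℝ × ℝ → ℝ) (x : ℝ × ℝ) : ℝ := ∑ i, ∑ j, wd j (wd i f) x ^ 2

/-- The strain `ε = e(φ_θ, φ_z) + ½ Dφ_ρ ⊗ Dφ_ρ + φ_ρ e_θ ⊗ e_θ`, by components. -/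
def strain (φ : Displacement) (i j : Fin 2) (x : ℝ × ℝ) : ℝ :=
  (wd i (φ.cyl j) x + wd j (φ.cyl i) x) / 2 + 1 / 2 * (wd i φ.rad x * wd j φ.rad x)
    + if i = 0 ∧ j = 0 then φ.rad x else 0

/-- The free-shear functional
`FS_h(φ) = ∫_Ω |ε_θθ|² + |ε_zz|² + h² |D²φ_ρ|² dθ dz`, with values in `[0, ∞]`. -/
def FS (h : ℝ) (φ : Displacement) : ℝ≥0∞ :=
  ∫⁻ x, ENNReal.ofReal (strain φ 0 0 x ^ 2 + strain φ 1 1 x ^ 2 + h ^ 2 * hessSq φ.rad x) ∂vol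

/-- The admissible set with axial confinement `lam`, mandrel radius `r` and slope bound `m`. -/
structure Admissible (lam r : ℝ) (m : ℝ≥0∞) (φ : Displacement) : Prop where
  rad_mem : MemH2per φ.rad
  theta_mem : MemH1per (φ.cyl 0)
  z_mem : MemH1per fun x => φ.cyl 1 x + lam * x.2
  obstacle : ∀ᵐ x ∂vol, r - 1 ≤ φ.rad x
  slope_rad : ∀ i, eLpNorm (wd i φ.rad) ∞ vol ≤ m
  slope_cyl : ∀ i j, eLpNorm (wd i (φ.cyl j)) ∞ vol ≤ m

/-- The admissible set `A_{λ,∞}`: neutral mandrel (radius `1`), no slope bound. -/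
def A (lam : ℝ) : Set Displacement := {φ | Admissible lam 1 ∞ φ}

end FreeShear

end

/-! ### The domain, integration by parts and weak derivatives of `C¹` functions -/

namespace FreeShear

/-! Low energy forces fine wrinkling, and wrinkling at bounded slope is expensive. Let `E` bound the
energy, `E ≪ λ²`. The mean of `ε_zz` is small, so the axial shortening must be absorbed by slope: `∫
(∂_z φ_ρ)² ≳ λ`. The mean of `ε_θθ` is small and, since `φ_ρ ≥ 0`, this mean controls the L¹ norm:
`‖φ_ρ‖₁ ≲ E^{1/2}`. The bending term gives `∫ (∂_z² φ_ρ)² ≤ E / h²`. If `|∂_z φ_ρ| ≤ m`, the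
interpolation `∫ (∂_z f)² ≲ (m / l) ‖f‖₁ + l² ∫ (∂_z² f)²`, optimized in `l`, makes these compatible
only when `λ³ h² ≲ m² E²` (`torus_interpolation`, `cube_mul_sq_le`).

For a minimizer one may take `E ~ (hλ)^{12/11}`, the energy of a helical wrinkle `φ_ρ = F(θ + κz)`
whose profile `F` is concentrated near one point of the period (`exists_periodic_bump`,
`exists_helical_displacement`, `exists_displacement_FS_le`). The two bounds together give `m ≳
λ^{3/2} h (hλ)^{-12/11} = h^{-1/11} λ^{9/22}`. The assumption `h ≪ λ^{5/6}` says exactly that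
`(hλ)^{12/11} ≪ λ²`, which the first step requires. -/

theorem Omega_eq_Icc : Omega = Icc ((0 : ℝ), (-1 / 2 : ℝ)) (2 * Real.pi, 1 / 2) := by
  rw [Omega, Icc_prod_Icc]

theorem isCompact_Omega : IsCompact Omega := isCompact_Icc.prod isCompact_Icc

theorem measurableSet_Omega : MeasurableSet Omega := measurableSet_Icc.prod measurableSet_Icc

theorem volume_Omega : volume Omega = ENNReal.ofReal (2 * Real.pi) := by
  rw [Omega, Measure.volume_eq_prod, Measure.prod_prod, Real.volume_Icc, Real.volume_Icc]
  norm_num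

instance isFiniteMeasure_vol : IsFiniteMeasure vol :=
  ⟨by rw [vol, Measure.restrict_apply_univ, volume_Omega]; exact ENNReal.ofReal_lt_top⟩

theorem vol_real_univ : vol.real univ = 2 * Real.pi := by
  rw [measureReal_def, vol, Measure.restrict_apply_univ, volume_Omega,
    ENNReal.toReal_ofReal (by positivity)]

theorem vol_eq_restrict_interior : vol = volume.restrict (interior Omega) :=
  (Measure.restrict_congr_set (interior_ae_eq_of_null_frontier
    (((convex_Icc 0 (2 * Real.pi)).prod (convex_Icc (-1 / 2) (1 / 2))).addHaar_frontier
      volume))).symm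

theorem interior_Omega :
    interior Omega = Ioo 0 (2 * Real.pi) ×ˢ Ioo (-1 / 2) (1 / 2) := by
  rw [Omega, interior_prod_eq, interior_Icc, interior_Icc]

theorem memLp_vol_of_continuous {u : ℝ × ℝ → ℝ} (hu : Continuous u) (p : ℝ≥0∞) :
    MemLp u p vol := by
  obtain ⟨c, hc⟩ := isCompact_Omega.exists_bound_of_continuousOn hu.continuousOn
  exact MemLp.of_bound hu.aestronglyMeasurable c
    ((ae_restrict_iff' measurableSet_Omega).2 (Eventually.of_forall hc))

theorem integrable_vol_of_continuous {u : ℝ × ℝ → ℝ} (hu : Continuous u) : Integrable u vol :=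
  memLp_one_iff_integrable.1 (memLp_vol_of_continuous hu 1)

theorem locallyIntegrableOn_of_integrable {u : ℝ × ℝ → ℝ} (hu : Integrable u vol) :
    LocallyIntegrableOn u (interior Omega) := by
  rw [vol_eq_restrict_interior] at hu
  exact IntegrableOn.locallyIntegrableOn hu

/-- Divergence theorem for the field with `w` in direction `i` and zero in the other: the fluxes
through opposite sides cancel. -/
theorem integral_fderiv_dir_eq_zero (i : Fin 2) {w : ℝ × ℝ → ℝ} (hw : ContDiff ℝ 1 w)
    (h0 : ∀ z, w (2 * Real.pi, z) = w (0, z)) (h1 : ∀ θ, w (θ, 1 / 2) = w (θ, -1 / 2)) :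
    ∫ x, fderiv ℝ w x (dir i) ∂vol = 0 := by
  have hc : Continuous (fderiv ℝ w) := hw.continuous_fderiv one_ne_zero
  have hd : ∀ x, HasFDerivAt w (fderiv ℝ w x) x := fun x =>
    (hw.differentiable one_ne_zero x).hasFDerivAt
  have hle : ((0 : ℝ), (-1 / 2 : ℝ)) ≤ (2 * Real.pi, 1 / 2) :=
    ⟨by positivity, by norm_num⟩
  rw [vol, Omega_eq_Icc]
  fin_cases i
  · have := integral_divergence_prod_Icc_of_hasFDerivAt_of_le w (fun _ => 0) (fderiv ℝ w)
      (fun _ => 0) _ _ hle hw.continuous.continuousOn continuousOn_const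
      (fun x _ => hd x) (fun x _ => hasFDerivAt_const _ _)
      (by
        refine Continuous.integrableOn_Icc ?_
        simp only [zero_apply, add_zero]
        fun_prop)
    simp only [zero_apply, add_zero, h0] at this
    simpa [dir] using this
  · have := integral_divergence_prod_Icc_of_hasFDerivAt_of_le (fun _ => 0) w
      (fun _ => 0) (fderiv ℝ w) _ _ hle continuousOn_const hw.continuous.continuousOn
      (fun x _ => hasFDerivAt_const _ _) (fun x _ => hd x)
      (by
        refine Continuous.integrableOn_Icc ?_
        simp only [zero_apply, zero_add]
        fun_prop)
    simp only [zero_apply, zero_add, h1] at this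
    simpa [dir] using this

/-- Integration by parts on `Ω` when the product takes equal values on opposite sides. -/
theorem integral_mul_fderiv_dir (i : Fin 2) {u ψ : ℝ × ℝ → ℝ} (hu : ContDiff ℝ 1 u)
    (hψ : ContDiff ℝ 1 ψ)
    (h0 : ∀ z, u (2 * Real.pi, z) * ψ (2 * Real.pi, z) = u (0, z) * ψ (0, z))
    (h1 : ∀ θ, u (θ, 1 / 2) * ψ (θ, 1 / 2) = u (θ, -1 / 2) * ψ (θ, -1 / 2)) :
    ∫ x, u x * fderiv ℝ ψ x (dir i) ∂vol = -∫ x, fderiv ℝ u x (dir i) * ψ x ∂vol := by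
  have hcu : Continuous (fderiv ℝ u) := hu.continuous_fderiv one_ne_zero
  have hcψ : Continuous (fderiv ℝ ψ) := hψ.continuous_fderiv one_ne_zero
  have hu' := hu.continuous
  have hψ' := hψ.continuous
  have := integral_fderiv_dir_eq_zero i (hu.mul hψ) h0 h1
  have heq : ∀ x, fderiv ℝ (fun x => u x * ψ x) x (dir i) =
      u x * fderiv ℝ ψ x (dir i) + fderiv ℝ u x (dir i) * ψ x := fun x => by
    rw [fderiv_fun_mul (hu.differentiable one_ne_zero x) (hψ.differentiable one_ne_zero x)]
    simp [mul_comm]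
  simp only [heq] at this
  rw [integral_add (integrable_vol_of_continuous (by fun_prop))
    (integrable_vol_of_continuous (by fun_prop))] at this
  linarith

theorem HasWeakDeriv.wd_ae_eq {i : Fin 2} {f g : ℝ × ℝ → ℝ} (h : HasWeakDeriv i f g) :
    HasWeakDeriv i f (wd i f) ∧ wd i f =ᵐ[vol] g := by
  have hex : ∃ g, HasWeakDeriv i f g := ⟨g, h⟩
  have h1 : HasWeakDeriv i f (wd i f) := by
    rw [wd, dif_pos hex]
    exact hex.choose_spec
  exact ⟨h1, h1.ae_unique h⟩

theorem HasWeakDeriv.of_contDiff (i : Fin 2) {f u : ℝ × ℝ → ℝ} (hu : ContDiff ℝ 1 u)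
    (hf : f =ᵐ[vol] u) : HasWeakDeriv i f fun x => fderiv ℝ u x (dir i) := by
  have hcu : Continuous (fderiv ℝ u) := hu.continuous_fderiv one_ne_zero
  refine ⟨locallyIntegrableOn_of_integrable
    ((integrable_vol_of_continuous hu.continuous).congr hf.symm),
    locallyIntegrableOn_of_integrable (integrable_vol_of_continuous (by fun_prop)), ?_⟩
  intro ψ hψ _ hs
  have hz : ∀ x, x ∉ interior Omega → ψ x = 0 := fun x hx =>
    image_eq_zero_of_notMem_tsupport fun h => hx (hs h)
  rw [interior_Omega] at hz
  rw [← integral_mul_fderiv_dir i hu (hψ.of_le (by norm_num))]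
  · exact integral_congr_ae (hf.mono fun x hx => by simp only [hx])
  · intro z
    rw [hz (2 * Real.pi, z) (by simp), hz (0, z) (by simp)]
    simp
  · intro θ
    rw [hz (θ, 1 / 2) (by simp), hz (θ, -1 / 2) (by simp)]
    simp

/-- Periodic functions of class `C¹` belong to `H¹_per(Ω)`, with the classical derivatives. -/
theorem memH1per_of_contDiff {f u : ℝ × ℝ → ℝ} (hu : ContDiff ℝ 1 u)
    (hθ : ∀ θ z, u (θ + 2 * Real.pi, z) = u (θ, z)) (hz : ∀ θ z, u (θ, z + 1) = u (θ, z))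
    (hf : f =ᵐ[vol] u) :
    MemH1per f ∧ ∀ i, wd i f =ᵐ[vol] fun x => fderiv ℝ u x (dir i) := by
  have hcu : Continuous (fderiv ℝ u) := hu.continuous_fderiv one_ne_zero
  have hwd := fun i => (HasWeakDeriv.of_contDiff i hu hf).wd_ae_eq
  refine ⟨⟨⟨(memLp_vol_of_continuous hu.continuous 2).ae_eq hf.symm, fun i => (hwd i).1,
    fun i => (memLp_vol_of_continuous (by fun_prop) 2).ae_eq (hwd i).2.symm⟩, ?_⟩,
    fun i => (hwd i).2⟩
  intro i ψ hψ
  have e1 : ∫ x, f x * fderiv ℝ ψ x (dir i) ∂vol = ∫ x, u x * fderiv ℝ ψ x (dir i) ∂vol :=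
    integral_congr_ae (hf.mono fun x hx => by simp only [hx])
  have e2 : ∫ x, wd i f x * ψ x ∂vol = ∫ x, fderiv ℝ u x (dir i) * ψ x ∂vol :=
    integral_congr_ae ((hwd i).2.mono fun x hx => by simp only [hx])
  rw [e1, e2]
  refine integral_mul_fderiv_dir i hu (hψ.smooth.of_le (by norm_num)) (fun z => ?_) fun θ => ?_
  · have a := hθ 0 z
    have b := hψ.periodic_theta 0 z
    rw [zero_add] at a b
    rw [a, b]
  · have a := hz θ (-1 / 2)
    have b := hψ.periodic_z θ (-1 / 2)
    rw [show (-1 / 2 + 1 : ℝ) = 1 / 2 by norm_num] at a b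
    rw [a, b]

/-! ### Fourier series and interpolation on the unit torus, with normalized Haar measure -/

open UnitAddTorus

noncomputable local instance instMeasureSpaceUnitAddCircle : MeasureSpace UnitAddCircle :=
  ⟨AddCircle.haarAddCircle⟩

local instance instIsAddHaarMeasureUnitAddCircle :
    Measure.IsAddHaarMeasure (volume : Measure UnitAddCircle) :=
  inferInstanceAs (Measure.IsAddHaarMeasure AddCircle.haarAddCircle)

local instance instIsProbabilityMeasureUnitAddCircle :
    IsProbabilityMeasure (volume : Measure UnitAddCircle) :=
  inferInstanceAs (IsProbabilityMeasure AddCircle.haarAddCircle)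

section Torus

variable {d : Type*} [Fintype d]

theorem mFourier_apply_add (n : d → ℤ) (x y : UnitAddTorus d) :
    mFourier n (x + y) = mFourier n x * mFourier n y := by
  simp only [mFourier, ContinuousMap.coe_mk, Pi.add_apply, fourier_apply, smul_add,
    AddCircle.toCircle_add, Circle.coe_mul, Finset.prod_mul_distrib]

theorem norm_mFourier_apply (n : d → ℤ) (x : UnitAddTorus d) : ‖mFourier n x‖ = 1 := by
  simp only [mFourier, ContinuousMap.coe_mk, fourier_apply, norm_prod, Circle.norm_coe,
    Finset.prod_const_one]

theorem mFourier_apply_single [DecidableEq d] (n : d → ℤ) (i : d) (l : ℝ) :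
    mFourier n (Pi.single i (l : UnitAddCircle)) =
      Complex.exp (2 * Real.pi * Complex.I * n i * l) := by
  simp only [mFourier, ContinuousMap.coe_mk]
  rw [Finset.prod_eq_single i]
  · rw [Pi.single_eq_same, fourier_coe_apply]
    congr 1
    push_cast
    ring
  · intro j _ hj
    rw [Pi.single_eq_of_ne hj, fourier_eval_zero]
  · simp

theorem mFourierCoeff_translate (f : UnitAddTorus d → ℂ) (c : UnitAddTorus d) (n : d → ℤ) :
    mFourierCoeff (fun t => f (t + c)) n = mFourier n c * mFourierCoeff f n := by
  have h := integral_add_right_eq_self (μ := (volume : Measure (UnitAddTorus d)))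
    (fun t => mFourier n c * (mFourier (-n) t • f t)) c
  rw [mFourierCoeff, mFourierCoeff, ← integral_const_mul, ← h]
  refine integral_congr_ae (Eventually.of_forall fun t => ?_)
  have hc : mFourier n c * mFourier (-n) c = 1 := by
    rw [mFourier_neg, Complex.mul_conj, Complex.normSq_eq_norm_sq, norm_mFourier_apply]
    simp
  simp only [mFourier_apply_add, smul_eq_mul]
  linear_combination (-(mFourier (-n) t * f (t + c))) * hc

theorem hasSum_sq_mFourierCoeff_of_memLp {F : UnitAddTorus d → ℂ} (hF : MemLp F 2 volume) :
    HasSum (fun n => ‖mFourierCoeff F n‖ ^ 2) (∫ t, ‖F t‖ ^ 2) := by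
  have h := hasSum_sq_mFourierCoeff (hF.toLp F)
  have e1 : ∀ n, mFourierCoeff (hF.toLp F) n = mFourierCoeff F n := fun n =>
    integral_congr_ae (hF.coeFn_toLp.mono fun t ht => by simp only [ht])
  have e2 : ∫ t, ‖hF.toLp F t‖ ^ 2 = ∫ t, ‖F t‖ ^ 2 :=
    integral_congr_ae (hF.coeFn_toLp.mono fun t ht => by simp only [ht])
  simpa only [e1, e2] using h

theorem integrable_mFourier_smul {F : UnitAddTorus d → ℂ} (hF : Integrable F volume)
    (n : d → ℤ) : Integrable (fun t => mFourier n t • F t) volume :=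
  hF.bdd_mul (mFourier n).continuous.aestronglyMeasurable
    (Eventually.of_forall fun t => (norm_mFourier_apply n t).le)

/-- Symbol of the error made when a derivative is replaced by a forward difference quotient of step
`l`. For `‖a * l‖ ≤ 1` this is Taylor's formula; otherwise the exponential has modulus one, as `a`
is imaginary, and the triangle inequality suffices. -/
theorem norm_sub_exp_sub_one_div_le (a : ℂ) {l : ℝ} (hl : 0 < l) (ha : a.re = 0) :
    ‖a - (Complex.exp (a * l) - 1) / l‖ ≤ 3 * l * ‖a‖ ^ 2 := by
  have hl' : (l : ℂ) ≠ 0 := by exact_mod_cast hl.ne'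
  have hn : ‖a * l‖ = ‖a‖ * l := by simp [abs_of_pos hl]
  have key : ‖Complex.exp (a * l) - 1 - a * l‖ ≤ 3 * ‖a * l‖ ^ 2 := by
    rcases le_total ‖a * l‖ 1 with h | h
    · have := Complex.norm_exp_sub_one_sub_id_le h
      nlinarith [sq_nonneg ‖a * l‖]
    · have h1 : ‖Complex.exp (a * l)‖ = 1 := by
        rw [Complex.norm_exp]; simp [ha]
      calc _ ≤ ‖Complex.exp (a * l)‖ + ‖(1 : ℂ)‖ + ‖a * l‖ :=
            (norm_sub_le _ _).trans (add_le_add_left (norm_sub_le _ _) _)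
        _ ≤ 3 * ‖a * l‖ ^ 2 := by
            rw [h1, norm_one]; nlinarith
  have : a - (Complex.exp (a * l) - 1) / l = -(Complex.exp (a * l) - 1 - a * l) / l := by
    field_simp
    ring
  rw [this, norm_div, norm_neg, Complex.norm_real, Real.norm_of_nonneg hl.le, div_le_iff₀ hl]
  rw [hn] at key
  linarith

/-- Interpolation on the torus: if `g = ∂ᵢf` and `G = ∂ᵢg` in the sense of Fourier coefficients,
`∫ g²` is controlled by `‖g‖_∞ ‖f‖₁` and `∫ G²`. -/
theorem torus_interpolation [DecidableEq d] (i : d) {f g G : UnitAddTorus d → ℝ} {m l : ℝ}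
    (hl : 0 < l) (hf : MemLp f 2 volume) (hg : MemLp g 2 volume) (hG : MemLp G 2 volume)
    (hfg : ∀ n, mFourierCoeff (fun t => (g t : ℂ)) n =
      2 * Real.pi * Complex.I * n i * mFourierCoeff (fun t => (f t : ℂ)) n)
    (hgG : ∀ n, mFourierCoeff (fun t => (G t : ℂ)) n =
      2 * Real.pi * Complex.I * n i * mFourierCoeff (fun t => (g t : ℂ)) n)
    (hm : ∀ᵐ t, |g t| ≤ m) :
    ∫ t, g t ^ 2 ≤ 4 * m / l * (∫ t, |f t|) + 9 * l ^ 2 * ∫ t, G t ^ 2 := by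
  set c : UnitAddTorus d := Pi.single i (l : UnitAddCircle) with hc
  have hmp : MeasurePreserving (fun t : UnitAddTorus d => t + c) volume volume :=
    measurePreserving_add_right volume c
  have hfc : MemLp (fun t => f (t + c)) 2 volume := hf.comp_measurePreserving hmp
  -- Splitting `g` into the difference quotient `D` of `f` and a remainder: `D` is bounded in L¹ by
  -- `2 ‖f‖₁ / l`, to be paired with `|g| ≤ m`, and the remainder is of order `l G` in L².
  set D : UnitAddTorus d → ℝ := fun t => l⁻¹ * (f (t + c) - f t) with hD
  have hD2 : MemLp D 2 volume := (hfc.sub hf).const_mul l⁻¹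
  have hu : MemLp (fun t => g t - D t) 2 volume := hg.sub hD2
  have cplx : ∀ {v : UnitAddTorus d → ℝ}, MemLp v 2 volume →
      MemLp (fun t => (v t : ℂ)) 2 volume := fun hv => hv.ofReal
  have cint : ∀ {v : UnitAddTorus d → ℝ}, MemLp v 2 volume →
      Integrable (fun t => (v t : ℂ)) volume := fun hv => (cplx hv).integrable one_le_two
  have sq : ∀ {v : UnitAddTorus d → ℝ}, MemLp v 2 volume →
      HasSum (fun n => ‖mFourierCoeff (fun t => (v t : ℂ)) n‖ ^ 2) (∫ t, v t ^ 2) := fun hv => by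
    simpa using hasSum_sq_mFourierCoeff_of_memLp (cplx hv)
  have hcoef : ∀ n, ‖mFourierCoeff (fun t => ((g t - D t : ℝ) : ℂ)) n‖ ^ 2 ≤
      9 * l ^ 2 * ‖mFourierCoeff (fun t => (G t : ℂ)) n‖ ^ 2 := by
    intro n
    set a : ℂ := 2 * Real.pi * Complex.I * n i with ha
    set b : ℂ := mFourierCoeff (fun t => (f t : ℂ)) n with hb
    have hare : a.re = 0 := by simp [ha]
    have h1 : mFourierCoeff (fun t => ((g t - D t : ℝ) : ℂ)) n =
        (a - (Complex.exp (a * l) - 1) / l) * b := by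
      have ht := mFourierCoeff_translate (fun t => (f t : ℂ)) c n
      rw [mFourier_apply_single] at ht
      have i1 := integrable_mFourier_smul (cint hg) (-n)
      have i2 := integrable_mFourier_smul (cint hfc) (-n)
      have i3 := integrable_mFourier_smul (cint hf) (-n)
      have e : mFourierCoeff (fun t => ((g t - D t : ℝ) : ℂ)) n =
          mFourierCoeff (fun t => (g t : ℂ)) n - (l : ℂ)⁻¹ *
            (mFourierCoeff (fun t => (f (t + c) : ℂ)) n - b) := by
        have i4 : Integrable (fun t => (l : ℂ)⁻¹ *
            (mFourier (-n) t • (f (t + c) : ℂ) - mFourier (-n) t • (f t : ℂ))) volume :=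
          (i2.sub i3).const_mul _
        rw [hb, mFourierCoeff, mFourierCoeff, mFourierCoeff, mFourierCoeff, ← integral_sub i2 i3,
          ← integral_const_mul, ← integral_sub i1 i4]
        refine integral_congr_ae (Eventually.of_forall fun t => ?_)
        simp only [hD, smul_eq_mul]
        push_cast
        ring
      rw [e, hfg, ht]
      ring
    have h2 : mFourierCoeff (fun t => (G t : ℂ)) n = a ^ 2 * b := by
      rw [hgG, hfg]
      ring
    have h3 := norm_sub_exp_sub_one_div_le a hl hare
    have h4 : ‖(a - (Complex.exp (a * l) - 1) / l) * b‖ ≤ 3 * l * ‖a ^ 2 * b‖ := by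
      rw [norm_mul, norm_mul, norm_pow]
      calc _ ≤ 3 * l * ‖a‖ ^ 2 * ‖b‖ := by gcongr
        _ = _ := by ring
    rw [h1, h2]
    calc _ ≤ (3 * l * ‖a ^ 2 * b‖) ^ 2 := by gcongr
      _ = _ := by ring
  have hu2 : ∫ t, (g t - D t) ^ 2 ≤ 9 * l ^ 2 * ∫ t, G t ^ 2 :=
    hasSum_le hcoef (sq hu) ((sq hG).mul_left _)
  have hfi : Integrable f volume := hf.integrable one_le_two
  have hfci : Integrable (fun t => f (t + c)) volume := hfc.integrable one_le_two
  have htr : ∫ t, |f (t + c)| = ∫ t, |f t| :=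
    integral_add_right_eq_self (μ := (volume : Measure (UnitAddTorus d))) (fun t => |f t|) c
  have hi : Integrable (fun t => 2 * (m * l⁻¹ * (|f (t + c)| + |f t|))) volume :=
    ((hfci.abs.add hfi.abs).const_mul _).const_mul _
  -- From `g² = 2 g D + (g - D)² - D²`, dropping the last square.
  have hpt : ∀ᵐ t, g t ^ 2 ≤ 2 * (m * l⁻¹ * (|f (t + c)| + |f t|)) + (g t - D t) ^ 2 := by
    filter_upwards [hm] with t ht
    have hDle : |D t| ≤ l⁻¹ * (|f (t + c)| + |f t|) := by
      rw [hD, abs_mul, abs_of_pos (inv_pos.2 hl)]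
      gcongr
      exact abs_sub _ _
    have h1 : g t * D t ≤ m * (l⁻¹ * (|f (t + c)| + |f t|)) := by
      calc g t * D t ≤ |g t * D t| := le_abs_self _
        _ = |g t| * |D t| := abs_mul _ _
        _ ≤ _ := mul_le_mul ht hDle (abs_nonneg _) ((abs_nonneg _).trans ht)
    nlinarith [sq_nonneg (D t)]
  calc ∫ t, g t ^ 2
      ≤ ∫ t, (2 * (m * l⁻¹ * (|f (t + c)| + |f t|)) + (g t - D t) ^ 2) :=
        integral_mono_ae hg.integrable_sq
          (hi.add hu.integrable_sq) hpt
    _ = 4 * m / l * (∫ t, |f t|) + ∫ t, (g t - D t) ^ 2 := by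
        rw [integral_add hi hu.integrable_sq,
          integral_const_mul, integral_const_mul, integral_add hfci.abs hfi.abs, htr]
        ring
    _ ≤ _ := by gcongr

end Torus

/-! ### Transfer of the interpolation inequality from the torus to `Ω` -/

section Transfer

/-- The section of the covering `ℝ → ℝ / ℤ` with values in `(a, a + 1]`. -/
noncomputable def circleSection (a : ℝ) (t : UnitAddCircle) : ℝ := (AddCircle.equivIoc 1 a t : ℝ)

theorem coe_circleSection (a : ℝ) (t : UnitAddCircle) : (circleSection a t : UnitAddCircle) = t :=
  (AddCircle.equivIoc 1 a).symm_apply_apply t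

theorem measurePreserving_circleSection (a : ℝ) :
    MeasurePreserving (circleSection a) volume (volume.restrict (Icc a (a + 1))) := by
  have h := (AddCircle.measurePreserving_equivIoc (T := 1) (a := a))
  rw [AddCircle.volume_eq_smul_haarAddCircle, ENNReal.ofReal_one, one_smul] at h
  have h2 : MeasurePreserving ((↑) : Ioc a (a + 1) → ℝ) (Measure.comap Subtype.val volume)
      (volume.restrict (Ioc a (a + 1))) :=
    ⟨measurable_subtype_coe, map_comap_subtype_coe measurableSet_Ioc volume⟩
  rw [restrict_Ioc_eq_restrict_Icc] at h2
  exact h2.comp h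

/-- The identification of the unit torus with `Ω`. -/
noncomputable def torusSection (t : UnitAddTorus (Fin 2)) : ℝ × ℝ :=
  (2 * Real.pi * circleSection 0 (t 0), circleSection (-1 / 2) (t 1))

theorem measurePreserving_two_pi_mul :
    MeasurePreserving (fun x : ℝ => 2 * Real.pi * x) (volume.restrict (Icc 0 1))
      (ENNReal.ofReal (2 * Real.pi)⁻¹ • volume.restrict (Icc 0 (2 * Real.pi))) := by
  have hpi : (0 : ℝ) < 2 * Real.pi := by positivity
  refine ⟨by fun_prop, ?_⟩
  have hpre : Icc (0 : ℝ) 1 = (fun x : ℝ => 2 * Real.pi * x) ⁻¹' Icc 0 (2 * Real.pi) := by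
    ext x
    simp only [mem_Icc, mem_preimage]
    refine and_congr (mul_nonneg_iff_of_pos_left hpi).symm ?_
    exact ⟨fun h => by nlinarith, fun h => by nlinarith⟩
  rw [hpre, ← Measure.restrict_map (by fun_prop) measurableSet_Icc,
    Real.map_volume_mul_left hpi.ne', Measure.restrict_smul, abs_of_pos (inv_pos.2 hpi)]

theorem measurePreserving_torusSection :
    MeasurePreserving torusSection volume (ENNReal.ofReal (2 * Real.pi)⁻¹ • vol) := by
  have h1 := volume_preserving_finTwoArrow UnitAddCircle
  have h2 := (measurePreserving_circleSection 0).prod (measurePreserving_circleSection (-1 / 2))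
  have h3 := measurePreserving_two_pi_mul.prod (MeasurePreserving.id
    (volume.restrict (Icc (-1 / 2 : ℝ) (1 / 2))))
  rw [zero_add, show (-1 / 2 + 1 : ℝ) = 1 / 2 by norm_num] at h2
  have h := h3.comp (h2.comp h1)
  rw [Measure.prod_smul_left, Measure.prod_restrict, ← Measure.volume_eq_prod] at h
  exact h

theorem memLp_comp_torusSection {f : ℝ × ℝ → ℝ} (hf : MemLp f 2 vol) :
    MemLp (fun t => f (torusSection t)) 2 volume :=
  (hf.smul_measure ENNReal.ofReal_ne_top).comp_measurePreserving measurePreserving_torusSection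

theorem ae_comp_torusSection {p : ℝ × ℝ → Prop} (h : ∀ᵐ x ∂vol, p x) :
    ∀ᵐ t, p (torusSection t) :=
  measurePreserving_torusSection.quasiMeasurePreserving.ae (Measure.ae_smul_measure h _)

theorem integral_comp_torusSection {E : Type*} [NormedAddCommGroup E] [NormedSpace ℝ E]
    {F : ℝ × ℝ → E} (hF : AEStronglyMeasurable F vol) :
    ∫ t, F (torusSection t) = (2 * Real.pi)⁻¹ • ∫ x, F x ∂vol := by
  have hpi : (0 : ℝ) < (2 * Real.pi)⁻¹ := by positivity
  have h := measurePreserving_torusSection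
  have h2 := integral_map (f := F) h.measurable.aemeasurable
    (by rw [h.map_eq]; exact hF.smul_measure _)
  rw [← h2, h.map_eq, integral_smul_measure, ENNReal.toReal_ofReal hpi.le]

/-- The phase of the Fourier monomial of frequency `n` on `Ω`. -/
noncomputable def phase (n : Fin 2 → ℤ) (x : ℝ × ℝ) : ℝ := n 0 * x.1 + 2 * Real.pi * n 1 * x.2

theorem mFourier_neg_eq_phase (n : Fin 2 → ℤ) (t : UnitAddTorus (Fin 2)) :
    mFourier (-n) t = ((Real.cos (phase n (torusSection t)) : ℝ) : ℂ) -
      Complex.I * (Real.sin (phase n (torusSection t)) : ℝ) := by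
  have h0 := coe_circleSection 0 (t 0)
  have h1 := coe_circleSection (-1 / 2) (t 1)
  simp only [mFourier, ContinuousMap.coe_mk, Fin.prod_univ_two]
  conv_lhs => rw [← h0, ← h1]
  rw [fourier_coe_apply, fourier_coe_apply, ← Complex.exp_add]
  have : ∀ y : ℝ, ((Real.cos y : ℝ) : ℂ) - Complex.I * (Real.sin y : ℝ) =
      Complex.exp (-(y * Complex.I)) := fun y => by
    rw [← neg_mul, ← Complex.ofReal_neg, Complex.exp_mul_I, ← Complex.ofReal_cos,
      ← Complex.ofReal_sin, Real.cos_neg, Real.sin_neg]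
    push_cast
    ring
  rw [this]
  congr 1
  simp only [phase, torusSection, Pi.neg_apply]
  push_cast
  ring

theorem contDiff_phase (n : Fin 2 → ℤ) : ContDiff ℝ ∞ (phase n) := by
  unfold phase
  fun_prop

theorem phase_add_theta (n : Fin 2 → ℤ) (θ z : ℝ) :
    phase n (θ + 2 * Real.pi, z) = phase n (θ, z) + n 0 * (2 * Real.pi) := by
  simp only [phase]
  ring

theorem phase_add_z (n : Fin 2 → ℤ) (θ z : ℝ) :
    phase n (θ, z + 1) = phase n (θ, z) + n 1 * (2 * Real.pi) := by
  simp only [phase]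
  ring

theorem fderiv_phase_dir_one (n : Fin 2 → ℤ) (x : ℝ × ℝ) :
    fderiv ℝ (phase n) x (dir 1) = 2 * Real.pi * n 1 := by
  have h : HasFDerivAt (phase n) ((n 0 : ℝ) • ContinuousLinearMap.fst ℝ ℝ ℝ +
      (2 * Real.pi * n 1) • ContinuousLinearMap.snd ℝ ℝ ℝ) x :=
    (hasFDerivAt_fst.const_mul _).add (hasFDerivAt_snd.const_mul _)
  rw [h.fderiv]
  simp [dir]

theorem isPeriodicTest_cos_phase (n : Fin 2 → ℤ) :
    IsPeriodicTest fun x => Real.cos (phase n x) where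
  smooth := Real.contDiff_cos.comp (contDiff_phase n)
  periodic_theta θ z := by rw [phase_add_theta, Real.cos_add_int_mul_two_pi]
  periodic_z θ z := by rw [phase_add_z, Real.cos_add_int_mul_two_pi]

theorem isPeriodicTest_sin_phase (n : Fin 2 → ℤ) :
    IsPeriodicTest fun x => Real.sin (phase n x) where
  smooth := Real.contDiff_sin.comp (contDiff_phase n)
  periodic_theta θ z := by rw [phase_add_theta, Real.sin_add_int_mul_two_pi]
  periodic_z θ z := by rw [phase_add_z, Real.sin_add_int_mul_two_pi]

/-- Real and imaginary parts are separated because periodicity in `MemH1per` is expressed with real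
test functions. -/
theorem mFourierCoeff_comp_torusSection {f : ℝ × ℝ → ℝ} (hf : Integrable f vol)
    (n : Fin 2 → ℤ) :
    mFourierCoeff (fun t => (f (torusSection t) : ℂ)) n =
      (2 * Real.pi : ℝ)⁻¹ * (((∫ x, f x * Real.cos (phase n x) ∂vol : ℝ) : ℂ) -
        Complex.I * (∫ x, f x * Real.sin (phase n x) ∂vol : ℝ)) := by
  have hp := (contDiff_phase n).continuous
  have hc : Integrable (fun x => f x * Real.cos (phase n x)) vol :=
    hf.mul_bdd (c := 1) (by fun_prop) (Eventually.of_forall fun x => Real.abs_cos_le_one _)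
  have hs : Integrable (fun x => f x * Real.sin (phase n x)) vol :=
    hf.mul_bdd (c := 1) (by fun_prop) (Eventually.of_forall fun x => Real.abs_sin_le_one _)
  have ic : Integrable (fun x => ((f x * Real.cos (phase n x) : ℝ) : ℂ)) vol := hc.ofReal
  have is : Integrable (fun x => Complex.I * ((f x * Real.sin (phase n x) : ℝ) : ℂ)) vol :=
    hs.ofReal.const_mul _
  have key := integral_comp_torusSection
    (F := fun x => ((f x * Real.cos (phase n x) : ℝ) : ℂ) -
      Complex.I * ((f x * Real.sin (phase n x) : ℝ) : ℂ))
    (ic.sub is).aestronglyMeasurable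
  rw [integral_sub ic is, integral_const_mul, integral_complex_ofReal,
    integral_complex_ofReal, Complex.real_smul] at key
  rw [← key, mFourierCoeff]
  refine integral_congr_ae (Eventually.of_forall fun t => ?_)
  simp only [mFourier_neg_eq_phase, smul_eq_mul]
  push_cast
  ring

/-- Integration by parts against the cosine and sine of the phase; the periodic definition of the
weak derivative leaves no boundary term. -/
theorem mFourierCoeff_wd_one {f : ℝ × ℝ → ℝ} (hf : MemH1per f) (n : Fin 2 → ℤ) :
    mFourierCoeff (fun t => (wd 1 f (torusSection t) : ℂ)) n =
      2 * Real.pi * Complex.I * n 1 * mFourierCoeff (fun t => (f (torusSection t) : ℂ)) n := by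
  have hd := fun x => ((contDiff_phase n).differentiable (by norm_num) x).hasFDerivAt
  have h1 := hf.periodic 1 _ (isPeriodicTest_cos_phase n)
  have h2 := hf.periodic 1 _ (isPeriodicTest_sin_phase n)
  have e1 : ∀ x, f x * fderiv ℝ (fun x => Real.cos (phase n x)) x (dir 1) =
      -(2 * Real.pi * n 1) * (f x * Real.sin (phase n x)) := fun x => by
    rw [(hd x).cos.fderiv]
    simp only [smul_apply, fderiv_phase_dir_one, smul_eq_mul]
    ring
  have e2 : ∀ x, f x * fderiv ℝ (fun x => Real.sin (phase n x)) x (dir 1) =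
      (2 * Real.pi * n 1) * (f x * Real.cos (phase n x)) := fun x => by
    rw [(hd x).sin.fderiv]
    simp only [smul_apply, fderiv_phase_dir_one, smul_eq_mul]
    ring
  simp only [e1, e2, integral_const_mul] at h1 h2
  rw [mFourierCoeff_comp_torusSection (hf.memH1.memLp.integrable one_le_two),
    mFourierCoeff_comp_torusSection ((hf.memH1.memLp_wd 1).integrable one_le_two)]
  have h3 : ∫ x, wd 1 f x * Real.cos (phase n x) ∂vol =
      2 * Real.pi * n 1 * ∫ x, f x * Real.sin (phase n x) ∂vol := by linarith
  have h4 : ∫ x, wd 1 f x * Real.sin (phase n x) ∂vol =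
      -(2 * Real.pi * n 1 * ∫ x, f x * Real.cos (phase n x) ∂vol) := by linarith
  rw [h3, h4]
  push_cast
  linear_combination (2 * Real.pi : ℂ)⁻¹ * (2 * Real.pi * n 1) *
    (∫ x, f x * Real.sin (phase n x) ∂vol : ℝ) * Complex.I_sq

/-- Interpolation between `‖f‖₁`, `‖∂_z f‖_∞` and `‖∂_z² f‖₂` for periodic functions on `Ω`. -/
theorem integral_sq_wd_one_le {f : ℝ × ℝ → ℝ} (hf : MemH2per f) {m l : ℝ} (hl : 0 < l)
    (hm : ∀ᵐ x ∂vol, |wd 1 f x| ≤ m) :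
    ∫ x, wd 1 f x ^ 2 ∂vol ≤
      4 * m / l * (∫ x, |f x| ∂vol) + 9 * l ^ 2 * ∫ x, wd 1 (wd 1 f) x ^ 2 ∂vol := by
  have hf0 := hf.memH1per.memH1.memLp
  have hf1 := hf.memH1per.memH1.memLp_wd 1
  have hf2 := (hf.wd_memH1per 1).memH1.memLp_wd 1
  have h := torus_interpolation 1 hl (memLp_comp_torusSection hf0) (memLp_comp_torusSection hf1)
    (memLp_comp_torusSection hf2) (mFourierCoeff_wd_one hf.memH1per)
    (mFourierCoeff_wd_one (hf.wd_memH1per 1)) (ae_comp_torusSection hm)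
  have e0 := integral_comp_torusSection hf0.aestronglyMeasurable.norm
  have e1 := integral_comp_torusSection (hf1.aestronglyMeasurable.pow 2)
  have e2 := integral_comp_torusSection (hf2.aestronglyMeasurable.pow 2)
  simp only [Pi.pow_apply, Real.norm_eq_abs, smul_eq_mul] at e0 e1 e2
  rw [e0, e1, e2] at h
  have hpi : (0 : ℝ) < (2 * Real.pi)⁻¹ := by positivity
  refine le_of_mul_le_mul_left ?_ hpi
  linarith

end Transfer

/-! ### Energy lower bound for displacements with bounded slopes -/

theorem HasWeakDeriv.sub {i : Fin 2} {f f' g g' : ℝ × ℝ → ℝ} (h : HasWeakDeriv i f g)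
    (h' : HasWeakDeriv i f' g') (hf : Integrable f vol) (hf' : Integrable f' vol)
    (hg : Integrable g vol) (hg' : Integrable g' vol) :
    HasWeakDeriv i (fun x => f x - f' x) fun x => g x - g' x := by
  refine ⟨h.1.sub h'.1, h.2.1.sub h'.2.1, fun ψ hψ hc hs => ?_⟩
  have hψd : Continuous fun x => fderiv ℝ ψ x (dir i) := by
    have := hψ.continuous_fderiv (by simp)
    fun_prop
  have bdd : ∀ {w v : ℝ × ℝ → ℝ}, Integrable w vol → Continuous v →
      Integrable (fun x => w x * v x) vol := fun hw hv => by
    obtain ⟨c, hc⟩ := isCompact_Omega.exists_bound_of_continuousOn hv.continuousOn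
    exact hw.mul_bdd hv.aestronglyMeasurable
      ((ae_restrict_iff' measurableSet_Omega).2 (Eventually.of_forall hc))
  simp only [sub_mul]
  rw [integral_sub (bdd hf hψd) (bdd hf' hψd), integral_sub (bdd hg hψ.continuous)
    (bdd hg' hψ.continuous), h.2.2 ψ hψ hc hs, h'.2.2 ψ hψ hc hs]
  ring

theorem MemH1per.integral_wd_eq_zero {f : ℝ × ℝ → ℝ} (hf : MemH1per f) (i : Fin 2) :
    ∫ x, wd i f x ∂vol = 0 := by
  have h := hf.periodic i (fun _ => 1) ⟨contDiff_const, fun _ _ => rfl, fun _ _ => rfl⟩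
  simpa using h

theorem sq_integral_vol_le {s : ℝ × ℝ → ℝ} (hs : Integrable s vol)
    (hs2 : Integrable (fun x => s x ^ 2) vol) :
    (∫ x, s x ∂vol) ^ 2 ≤ 2 * Real.pi * ∫ x, s x ^ 2 ∂vol := by
  have hpi : (0 : ℝ) < 2 * Real.pi := by positivity
  set I := ∫ x, s x ∂vol with hI
  -- Nonnegativity of the variance of `s`; the total mass of `vol` is `2π`.
  have h : 0 ≤ ∫ x, (s x ^ 2 - 2 * (I / (2 * Real.pi)) * s x + (I / (2 * Real.pi)) ^ 2) ∂vol :=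
    integral_nonneg fun x => by
      simp only [Pi.zero_apply]
      nlinarith [sq_nonneg (s x - I / (2 * Real.pi))]
  have hd : Integrable (fun x => s x ^ 2 - 2 * (I / (2 * Real.pi)) * s x) vol :=
    hs2.sub (hs.const_mul _)
  rw [integral_add hd (integrable_const _), integral_sub hs2 (hs.const_mul _), integral_const_mul, integral_const, ← hI, smul_eq_mul,
    vol_real_univ] at h
  have e : (2 * Real.pi) * (I / (2 * Real.pi)) = I := by field_simp
  nlinarith

theorem integral_le_of_lintegral_ofReal_le {w : ℝ × ℝ → ℝ} (hw : AEStronglyMeasurable w vol)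
    (h0 : ∀ x, 0 ≤ w x) {E : ℝ} (hE : 0 ≤ E)
    (h : ∫⁻ x, ENNReal.ofReal (w x) ∂vol ≤ ENNReal.ofReal E) :
    Integrable w vol ∧ ∫ x, w x ∂vol ≤ E := by
  refine ⟨(lintegral_ofReal_ne_top_iff_integrable hw (Eventually.of_forall h0)).1
    (h.trans_lt ENNReal.ofReal_lt_top).ne, ?_⟩
  rw [integral_eq_lintegral_of_nonneg_ae (Eventually.of_forall h0) hw]
  exact ENNReal.toReal_le_of_le_ofReal hE h

/-- The scale `l` is chosen so that the second-derivative term is at most `Γ / 2` and can be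
absorbed; what remains is `Γ l ≤ 8 m L`, which is then squared. -/
theorem cube_mul_sq_le_of_interpolation {h lam E m L Γ S : ℝ} (hh : 0 < h) (hlam : 0 < lam)
    (hE : 0 < E) (hm0 : 0 ≤ m) (hL0 : 0 ≤ L) (hL : L ^ 2 ≤ 2 * Real.pi * E)
    (hΓ : 2 * Real.pi * lam ≤ Γ) (hS : h ^ 2 * S ≤ E)
    (interp : ∀ l, 0 < l → Γ ≤ 4 * m / l * L + 9 * l ^ 2 * S) :
    lam ^ 3 * h ^ 2 ≤ 32 * m ^ 2 * E ^ 2 := by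
  have hpi := Real.pi_gt_three
  have hΓ0 : 0 < Γ := lt_of_lt_of_le (by positivity) hΓ
  set l := Real.sqrt (Γ * h ^ 2 / (18 * E)) with hl
  have hl0 : 0 < l := Real.sqrt_pos.2 (by positivity)
  have hl2 : l ^ 2 = Γ * h ^ 2 / (18 * E) := Real.sq_sqrt (by positivity)
  have h1 := interp l hl0
  have h2 : 9 * l ^ 2 * S ≤ Γ / 2 := by
    rw [hl2]
    calc 9 * (Γ * h ^ 2 / (18 * E)) * S = Γ / (2 * E) * (h ^ 2 * S) := by field_simp; ring
      _ ≤ Γ / (2 * E) * E := by gcongr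
      _ = Γ / 2 := by field_simp
  have h3 : Γ * l ≤ 8 * m * L := by
    have : Γ / 2 ≤ 4 * m / l * L := by linarith
    rw [div_mul_eq_mul_div, le_div_iff₀ hl0] at this
    linarith
  have h4 : Γ ^ 2 * l ^ 2 ≤ 64 * m ^ 2 * L ^ 2 := by
    calc Γ ^ 2 * l ^ 2 = (Γ * l) ^ 2 := by ring
      _ ≤ (8 * m * L) ^ 2 := by gcongr
      _ = _ := by ring
  have h5 : Γ ^ 3 * h ^ 2 ≤ 2304 * Real.pi * m ^ 2 * E ^ 2 := by
    have h6 : Γ ^ 2 * l ^ 2 ≤ 64 * m ^ 2 * (2 * Real.pi * E) :=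
      h4.trans (by gcongr)
    rw [hl2, ← mul_div_assoc, div_le_iff₀ (by positivity)] at h6
    linarith
  have h7 : (2 * Real.pi * lam) ^ 3 * h ^ 2 ≤ 2304 * Real.pi * m ^ 2 * E ^ 2 :=
    le_trans (by gcongr) h5
  have h8 : Real.pi ^ 2 * (lam ^ 3 * h ^ 2) ≤ 288 * (m ^ 2 * E ^ 2) := by
    have : (8 * Real.pi) * (Real.pi ^ 2 * (lam ^ 3 * h ^ 2)) ≤
        (8 * Real.pi) * (288 * (m ^ 2 * E ^ 2)) := by linarith
    exact le_of_mul_le_mul_left this (by positivity)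
  -- Since `π² ≥ 9`, the constant becomes `288 / 9 = 32`.
  have h9 : 9 * (lam ^ 3 * h ^ 2) ≤ Real.pi ^ 2 * (lam ^ 3 * h ^ 2) := by
    gcongr
    nlinarith
  linarith

/-- Displacements with small slopes have large energy. -/
theorem cube_mul_sq_le {h lam E m : ℝ} {φ : Displacement} (hh : 0 < h) (hlam : 0 < lam)
    (hE : 0 < E) (hElam : 2 * E ≤ Real.pi * lam ^ 2) (hφ : φ ∈ A lam)
    (hFS : FS h φ ≤ ENNReal.ofReal E) (hm : ∀ᵐ x ∂vol, |wd 1 φ.rad x| ≤ m) :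
    lam ^ 3 * h ^ 2 ≤ 32 * m ^ 2 * E ^ 2 := by
  have hpi := Real.pi_gt_three
  have hrad := hφ.rad_mem
  have hf := hrad.memH1per.memH1.memLp
  have hp := hrad.memH1per.memH1.memLp_wd 0
  have hg := hrad.memH1per.memH1.memLp_wd 1
  have hG := (hrad.wd_memH1per 1).memH1.memLp_wd 1
  have hθ := hφ.theta_mem.memH1.memLp_wd 0
  have hζ := hφ.z_mem
  have hid : HasWeakDeriv 1 (fun x : ℝ × ℝ => lam * x.2) fun _ => lam := by
    have := HasWeakDeriv.of_contDiff 1 (u := fun x : ℝ × ℝ => lam * x.2) (by fun_prop)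
      EventuallyEq.rfl
    convert this using 2 with x
    rw [(hasFDerivAt_snd.const_mul lam).fderiv]
    simp [dir]
  -- Only `φ_z + λz` is periodic, so it is its derivative that has zero mean; hence `∂_z φ_z` has
  -- integral `-2πλ`.
  have hz : wd 1 (φ.cyl 1) =ᵐ[vol] fun x => wd 1 (fun x => φ.cyl 1 x + lam * x.2) x - lam := by
    have := (hζ.memH1.hasWeakDeriv 1).sub hid (hζ.memH1.memLp.integrable one_le_two)
      (integrable_vol_of_continuous (by fun_prop))
      ((hζ.memH1.memLp_wd 1).integrable one_le_two) (integrable_const _)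
    simp only [add_sub_cancel_right] at this
    exact this.wd_ae_eq.2
  have hzint : Integrable (wd 1 (φ.cyl 1)) vol :=
    (((hζ.memH1.memLp_wd 1).integrable one_le_two).sub (integrable_const lam)).congr hz.symm
  have hzval : ∫ x, wd 1 (φ.cyl 1) x ∂vol = -(2 * Real.pi * lam) := by
    rw [integral_congr_ae hz, integral_sub ((hζ.memH1.memLp_wd 1).integrable one_le_two)
      (integrable_const _), hζ.integral_wd_eq_zero, integral_const, vol_real_univ, smul_eq_mul]
    ring
  have s0 : strain φ 0 0 = fun x => wd 0 (φ.cyl 0) x + 1 / 2 * wd 0 φ.rad x ^ 2 + φ.rad x := by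
    funext x
    simp only [strain, and_self, if_true]
    ring
  have s1 : strain φ 1 1 = fun x => wd 1 (φ.cyl 1) x + 1 / 2 * wd 1 φ.rad x ^ 2 := by
    funext x
    simp [strain]
    ring
  have hfi := hf.integrable one_le_two
  have hθi := hθ.integrable one_le_two
  have hθp : Integrable (fun x => wd 0 (φ.cyl 0) x + 1 / 2 * wd 0 φ.rad x ^ 2) vol :=
    hθi.add (hp.integrable_sq.const_mul _)
  have i0 : Integrable (strain φ 0 0) vol := by
    rw [s0]
    exact hθp.add hfi
  have i1 : Integrable (strain φ 1 1) vol := by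
    rw [s1]
    exact hzint.add (hg.integrable_sq.const_mul _)
  have hmono : ∀ {w : ℝ × ℝ → ℝ}, AEStronglyMeasurable w vol → (∀ x, 0 ≤ w x) →
      (∀ x, w x ≤ strain φ 0 0 x ^ 2 + strain φ 1 1 x ^ 2 + h ^ 2 * hessSq φ.rad x) →
      Integrable w vol ∧ ∫ x, w x ∂vol ≤ E := fun hw h0 hle =>
    integral_le_of_lintegral_ofReal_le hw h0 hE.le
      ((lintegral_mono fun x => ENNReal.ofReal_le_ofReal (hle x)).trans hFS)
  have hH : ∀ x, wd 1 (wd 1 φ.rad) x ^ 2 ≤ hessSq φ.rad x := fun x => by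
    simp only [hessSq, Fin.sum_univ_two]
    nlinarith [sq_nonneg (wd 0 (wd 0 φ.rad) x), sq_nonneg (wd 1 (wd 0 φ.rad) x),
      sq_nonneg (wd 0 (wd 1 φ.rad) x)]
  have hH0 : ∀ x, 0 ≤ h ^ 2 * hessSq φ.rad x := fun x =>
    mul_nonneg (sq_nonneg _) ((sq_nonneg _).trans (hH x))
  have b0 := hmono (i0.aestronglyMeasurable.pow 2) (fun x => sq_nonneg _) fun x => by
    simp only [Pi.pow_apply]
    nlinarith [sq_nonneg (strain φ 1 1 x), hH0 x]
  have b1 := hmono (i1.aestronglyMeasurable.pow 2) (fun x => sq_nonneg _) fun x => by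
    simp only [Pi.pow_apply]
    nlinarith [sq_nonneg (strain φ 0 0 x), hH0 x]
  have b2 := hmono (w := fun x => h ^ 2 * wd 1 (wd 1 φ.rad) x ^ 2)
    (hG.integrable_sq.const_mul _).aestronglyMeasurable (fun x => by positivity) fun x => by
      nlinarith [sq_nonneg (strain φ 0 0 x), sq_nonneg (strain φ 1 1 x),
        mul_le_mul_of_nonneg_left (hH x) (sq_nonneg h)]
  simp only [Pi.pow_apply] at b0 b1
  have c0 := sq_integral_vol_le i0 b0.1
  have c1 := sq_integral_vol_le i1 b1.1
  have v0 : ∫ x, strain φ 0 0 x ∂vol =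
      1 / 2 * (∫ x, wd 0 φ.rad x ^ 2 ∂vol) + ∫ x, φ.rad x ∂vol := by
    rw [s0, integral_add hθp hfi,
      integral_add hθi (hp.integrable_sq.const_mul _), hφ.theta_mem.integral_wd_eq_zero,
      integral_const_mul, zero_add]
  have v1 : ∫ x, strain φ 1 1 x ∂vol =
      -(2 * Real.pi * lam) + 1 / 2 * ∫ x, wd 1 φ.rad x ^ 2 ∂vol := by
    rw [s1, integral_add hzint (hg.integrable_sq.const_mul _), hzval, integral_const_mul]
  -- The obstacle turns the integral of `φ_ρ` into an L¹ norm.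
  have habs : ∫ x, |φ.rad x| ∂vol = ∫ x, φ.rad x ∂vol :=
    integral_congr_ae (hφ.obstacle.mono fun x hx => abs_of_nonneg (by linarith))
  have hL0 : 0 ≤ ∫ x, |φ.rad x| ∂vol := integral_nonneg fun x => abs_nonneg _
  have hP0 : 0 ≤ ∫ x, wd 0 φ.rad x ^ 2 ∂vol := integral_nonneg fun x => sq_nonneg _
  rw [integral_const_mul] at b2
  have interp := fun l (hl : 0 < l) => integral_sq_wd_one_le hrad hl hm
  have hm0 : 0 ≤ m := by
    have hne : vol ≠ 0 := fun h0 => by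
      have := vol_real_univ
      simp [h0] at this
    have : NeZero vol := ⟨hne⟩
    obtain ⟨x, hx⟩ := hm.exists
    exact (abs_nonneg _).trans hx
  rw [← habs] at v0
  set L := ∫ x, |φ.rad x| ∂vol
  set P := ∫ x, wd 0 φ.rad x ^ 2 ∂vol
  set Γ := ∫ x, wd 1 φ.rad x ^ 2 ∂vol
  set S := ∫ x, wd 1 (wd 1 φ.rad) x ^ 2 ∂vol
  -- Both terms of the mean hoop strain `P / 2 + L` are nonnegative, so neither can cancel the
  -- other.
  have hL : L ^ 2 ≤ 2 * Real.pi * E := by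
    rw [v0] at c0
    have : L ^ 2 ≤ (1 / 2 * P + L) ^ 2 := by gcongr; linarith
    nlinarith [b0.2]
  -- The energy bound `2 E ≤ π λ²` keeps the integral of `ε_zz` within `πλ` of zero, so at least
  -- half of the shortening `2πλ` is compensated by `Γ / 2`.
  have hΓ : 2 * Real.pi * lam ≤ Γ := by
    rw [v1] at c1
    have h1 : (-(2 * Real.pi * lam) + 1 / 2 * Γ) ^ 2 ≤ (Real.pi * lam) ^ 2 := by
      nlinarith [b1.2]
    have := (abs_le.1 (abs_le_of_sq_le_sq h1 (by positivity))).1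
    linarith
  exact cube_mul_sq_le_of_interpolation hh hlam hE hm0 hL0 hL hΓ b2.2 interp

/-! ### One-dimensional periodic profiles -/

section Profile

open Real

theorem integral_sin_pow_add_two (k : ℕ) :
    ∫ x in 0..π, sin x ^ (k + 2) = (k + 1) / (k + 2) * ∫ x in 0..π, sin x ^ k := by
  rw [integral_sin_pow]
  simp

/-- Wallis: the product of two consecutive sine integrals is explicit. As these integrals decrease
with the exponent, each is of order `k ^ (-1/2)`. -/
theorem integral_sin_pow_succ_mul (k : ℕ) :
    (∫ x in 0..π, sin x ^ (k + 1)) * (∫ x in 0..π, sin x ^ k) = 2 * π / (k + 1) := by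
  induction k with
  | zero => norm_num
  | succ k ih =>
    rw [integral_sin_pow_add_two]
    push_cast
    have h1 : (k : ℝ) + 1 ≠ 0 := by positivity
    have h2 : (k : ℝ) + 2 ≠ 0 := by positivity
    calc _ = (k + 1 : ℝ) / (k + 2) *
          ((∫ x in 0..π, sin x ^ (k + 1)) * (∫ x in 0..π, sin x ^ k)) := by ring
      _ = _ := by
        rw [ih]
        have h3 : (k : ℝ) + 1 + 1 ≠ 0 := by positivity
        field_simp
        ring

theorem integral_comp_half (u : ℝ → ℝ) :
    ∫ s in 0..2 * π, u (s / 2) = 2 * ∫ t in 0..π, u t := by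
  rw [intervalIntegral.integral_comp_div _ two_ne_zero, smul_eq_mul, zero_div,
    mul_div_cancel_left₀ _ two_ne_zero]

/-- Nonnegative `2π`-periodic bumps of width of order `1 / K`, normalized by the `L²` norm of
their derivative. -/
theorem exists_periodic_bump {K : ℕ} (hK : 1 ≤ K) {μ : ℝ} (hμ : 0 < μ) :
    ∃ F F₁ F₂ : ℝ → ℝ, (∀ s, HasDerivAt F (F₁ s) s) ∧ (∀ s, HasDerivAt F₁ (F₂ s) s) ∧
      Continuous F₂ ∧ Function.Periodic F (2 * π) ∧ Function.Periodic F₁ (2 * π) ∧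
      Function.Periodic F₂ (2 * π) ∧
      (∀ s, 0 ≤ F s) ∧ ∫ s in 0..2 * π, F₁ s ^ 2 = μ ∧
      ∫ s in 0..2 * π, F₂ s ^ 2 ≤ K ^ 2 * μ ∧
      (∫ s in 0..2 * π, F s) ^ 2 ≤ 8 * π * μ / K ^ 3 := by
  -- The profile is `A sin(s/2)^{2K²}`: a power of order `K²` concentrates at width `1 / K`. The
  -- even exponent gives nonnegativity and period `2π`.
  obtain ⟨k, hk⟩ : ∃ k : ℕ, k + 1 = K ^ 2 := ⟨K ^ 2 - 1, Nat.sub_add_cancel (Nat.one_le_pow _ _ hK)⟩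
  have hkR : (k : ℝ) + 1 = (K : ℝ) ^ 2 := by exact_mod_cast hk
  have hK0 : (0 : ℝ) < K := by exact_mod_cast hK
  set V : ℝ := ∫ x in 0..π, sin x ^ (4 * k + 2) with hV
  have hV0 : 0 < V := integral_sin_pow_pos _
  -- The amplitude that normalizes `∫ F₁²`, which equals `A² (k + 1) V / 2`.
  set A : ℝ := √(2 * μ / ((k + 1) * V)) with hA
  have hA2 : A ^ 2 = 2 * μ / ((k + 1) * V) := sq_sqrt (by positivity)
  have hA0 : 0 ≤ A := sqrt_nonneg _
  have hW4 : ∫ x in 0..π, sin x ^ (4 * k + 4) = (4 * k + 3) / (4 * k + 4) * V := by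
    rw [hV, integral_sin_pow_add_two (4 * k + 2)]
    push_cast
    ring
  have hW0 : V = (4 * k + 1) / (4 * k + 2) * ∫ x in 0..π, sin x ^ (4 * k) := by
    rw [hV, integral_sin_pow_add_two (4 * k)]
    push_cast
    ring
  have hcont : ∀ p : ℕ, IntervalIntegrable (fun x => sin x ^ p) volume 0 π := fun p =>
    (by fun_prop : Continuous fun x => sin x ^ p).intervalIntegrable _ _
  have hsc : ∀ x : ℝ, cos x ^ 2 = 1 - sin x ^ 2 := fun x => cos_sq' x
  have hsin : ∀ s, sin ((s + 2 * π) / 2) = -sin (s / 2) := fun s => by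
    rw [add_div, mul_div_cancel_left₀ _ two_ne_zero, sin_add_pi]
  have hcos : ∀ s, cos ((s + 2 * π) / 2) = -cos (s / 2) := fun s => by
    rw [add_div, mul_div_cancel_left₀ _ two_ne_zero, cos_add_pi]
  have heven : ∀ p : ℕ, ∀ y : ℝ, (-y) ^ (2 * p) = y ^ (2 * p) := fun p y =>
    (even_two_mul p).neg_pow y
  have dS : ∀ s : ℝ, HasDerivAt (fun s => sin (s / 2)) (cos (s / 2) * (1 / 2)) s := fun s =>
    ((hasDerivAt_id s).div_const 2).sin
  have dC : ∀ s : ℝ, HasDerivAt (fun s => cos (s / 2)) (-sin (s / 2) * (1 / 2)) s := fun s =>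
    ((hasDerivAt_id s).div_const 2).cos
  refine ⟨fun s => A * sin (s / 2) ^ (2 * (k + 1)),
    fun s => A * (k + 1) * (sin (s / 2) ^ (2 * k + 1) * cos (s / 2)),
    fun s => A * (k + 1) * ((2 * k + 1) / 2 * sin (s / 2) ^ (2 * k) -
      (k + 1) * sin (s / 2) ^ (2 * (k + 1))), ?_, ?_, by fun_prop, ?_, ?_, ?_, ?_, ?_, ?_, ?_⟩
  · intro s
    refine (((dS s).pow (2 * (k + 1))).const_mul A).congr_deriv ?_
    rw [show 2 * (k + 1) - 1 = 2 * k + 1 by omega]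
    push_cast
    ring
  · intro s
    refine ((((dS s).pow (2 * k + 1)).mul (dC s)).const_mul (A * (k + 1))).congr_deriv ?_
    simp only [Pi.pow_apply, Nat.add_sub_cancel]
    push_cast
    have := hsc (s / 2)
    linear_combination A * (k + 1) * ((2 * k + 1) / 2) * sin (s / 2) ^ (2 * k) * this
  · intro s
    simp only [hsin, heven]
  · intro s
    simp only [hsin, hcos, pow_succ, heven]
    ring
  · intro s
    simp only [hsin, heven]
  · intro s
    have := (even_two_mul (k + 1)).pow_nonneg (sin (s / 2))
    positivity
  · have e : ∀ t : ℝ, (A * (k + 1) * (sin t ^ (2 * k + 1) * cos t)) ^ 2 =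
        (A * (k + 1)) ^ 2 * (sin t ^ (4 * k + 2) - sin t ^ (4 * k + 4)) := fun t => by
      linear_combination (A * (k + 1)) ^ 2 * (sin t ^ (2 * k + 1)) ^ 2 * hsc t
    rw [integral_comp_half fun t => (A * (k + 1) * (sin t ^ (2 * k + 1) * cos t)) ^ 2]
    simp only [e]
    rw [intervalIntegral.integral_const_mul, intervalIntegral.integral_sub (hcont _) (hcont _),
      ← hV, hW4, mul_pow, hA2]
    field_simp
    ring
  · have e : ∀ t : ℝ, (A * (k + 1) * ((2 * k + 1) / 2 * sin t ^ (2 * k) -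
        (k + 1) * sin t ^ (2 * (k + 1)))) ^ 2 =
        (A * (k + 1)) ^ 2 * ((2 * k + 1) ^ 2 / 4 * sin t ^ (4 * k) -
          (2 * k + 1) * (k + 1) * sin t ^ (4 * k + 2) + (k + 1) ^ 2 * sin t ^ (4 * k + 4)) :=
      fun t => by ring
    rw [integral_comp_half fun t => (A * (k + 1) * ((2 * k + 1) / 2 * sin t ^ (2 * k) -
        (k + 1) * sin t ^ (2 * (k + 1)))) ^ 2]
    simp only [e]
    rw [intervalIntegral.integral_const_mul, intervalIntegral.integral_add
      (((hcont _).const_mul _).sub ((hcont _).const_mul _)) ((hcont _).const_mul _),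
      intervalIntegral.integral_sub ((hcont _).const_mul _) ((hcont _).const_mul _),
      intervalIntegral.integral_const_mul, intervalIntegral.integral_const_mul,
      intervalIntegral.integral_const_mul, ← hV, hW4, mul_pow, hA2]
    have hw : ∫ x in 0..π, sin x ^ (4 * k) = (4 * k + 2) / (4 * k + 1) * V := by
      rw [hW0]
      field_simp
    rw [hw, ← hkR]
    -- The exact value of `∫ F₂²`: `K² μ` times a factor at most one.
    have e2 : 2 * (2 * μ / ((k + 1) * V) * (k + 1) ^ 2 * ((2 * k + 1) ^ 2 / 4 *
        ((4 * k + 2) / (4 * k + 1) * V) - (2 * k + 1) * (k + 1) * V +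
        (k + 1) ^ 2 * ((4 * k + 3) / (4 * k + 4) * V))) =
        (k + 1) * μ * ((3 * k + 1) / (4 * k + 1)) := by
      field_simp
      ring
    rw [e2]
    refine mul_le_of_le_one_right (by positivity) ((div_le_one (by positivity)).2 ?_)
    have : (0 : ℝ) ≤ k := k.cast_nonneg
    linarith
  · rw [integral_comp_half fun t => A * sin t ^ (2 * (k + 1)),
      intervalIntegral.integral_const_mul]
    set W : ℝ := ∫ x in 0..π, sin x ^ (2 * (k + 1)) with hW
    have hWpos : 0 < W := integral_sin_pow_pos _
    have hW2 : W ^ 2 ≤ π / K ^ 2 := by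
      have h1 : W * (∫ x in 0..π, sin x ^ (2 * k + 1)) = 2 * π / ((2 * k + 1 : ℕ) + 1) :=
        integral_sin_pow_succ_mul (2 * k + 1)
      have h2 : W ≤ ∫ x in 0..π, sin x ^ (2 * k + 1) := integral_sin_pow_succ_le _
      have h3 : 2 * π / (((2 * k + 1 : ℕ) : ℝ) + 1) = π / K ^ 2 := by
        rw [← hkR]
        push_cast
        field_simp
        ring
      rw [← h3, ← h1, sq]
      gcongr
    have hVK : 1 / (K : ℝ) ≤ V := by
      have h1 := integral_sin_pow_succ_mul (4 * k + 2)
      rw [← hV] at h1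
      have h2 : ∫ x in 0..π, sin x ^ (4 * k + 2 + 1) ≤ V := integral_sin_pow_succ_le _
      have h3 : 1 / ((k : ℝ) + 1) ≤ 2 * π / ((4 * k + 2 : ℕ) + 1) := by
        push_cast
        rw [div_le_div_iff₀ (by positivity) (by positivity)]
        have := pi_gt_three
        have hk0 : (0 : ℝ) ≤ k := k.cast_nonneg
        nlinarith
      refine le_of_sq_le_sq ?_ hV0.le
      rw [div_pow, one_pow, ← hkR]
      refine h3.trans ?_
      rw [← h1, sq]
      gcongr
    have hA3 : A ^ 2 ≤ 2 * μ / K := by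
      rw [hA2, hkR]
      refine div_le_div_of_nonneg_left (by positivity) hK0 ?_
      calc (K : ℝ) = K ^ 2 * (1 / K) := by field_simp
        _ ≤ K ^ 2 * V := by gcongr
    calc (2 * (A * W)) ^ 2 = 4 * A ^ 2 * W ^ 2 := by ring
      _ ≤ 4 * (2 * μ / K) * (π / K ^ 2) := by gcongr
      _ = 8 * π * μ / K ^ 3 := by field_simp; ring

/-- Used to choose tangential displacements that cancel the oscillating part of a strain: zero mean
is what makes the primitive periodic. -/
theorem exists_periodic_primitive {v : ℝ → ℝ} {T : ℝ} (hv : Continuous v)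
    (hp : Function.Periodic v T) (h0 : ∫ s in 0..T, v s = 0) :
    ∃ u : ℝ → ℝ, Function.Periodic u T ∧ ∀ s, HasDerivAt u (v s) s := by
  refine ⟨fun s => ∫ t in 0..s, v t, fun s => ?_, fun s =>
    intervalIntegral.integral_hasDerivAt_right (hv.intervalIntegrable _ _)
      hv.stronglyMeasurable.stronglyMeasurableAtFilter hv.continuousAt⟩
  have h1 := hp.intervalIntegral_add_eq s 0
  rw [zero_add, h0] at h1
  have h2 := intervalIntegral.integral_add_adjacent_intervals
    (hv.intervalIntegrable (μ := volume) 0 s) (hv.intervalIntegrable s (s + T))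
  simp only
  rw [← h2, h1, add_zero]

end Profile

/-! ### Helical wrinkles and the upper bound for the energy -/

/-- The helical phase `θ + κz`. -/
def helix (κ : ℝ) (x : ℝ × ℝ) : ℝ := x.1 + κ * x.2

/-- The partial derivatives of the helical phase. -/
def helixSlope (κ : ℝ) : Fin 2 → ℝ := ![1, κ]

theorem continuous_helix (κ : ℝ) : Continuous (helix κ) := by
  unfold helix
  fun_prop

theorem contDiff_one_of_hasDerivAt {u v : ℝ → ℝ} (hu : ∀ s, HasDerivAt u (v s) s)
    (hv : Continuous v) : ContDiff ℝ 1 u := by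
  rw [contDiff_one_iff_deriv]
  exact ⟨fun s => (hu s).differentiableAt, by rwa [funext fun s => (hu s).deriv]⟩

theorem hasFDerivAt_helix (κ : ℝ) (x : ℝ × ℝ) :
    HasFDerivAt (helix κ) (ContinuousLinearMap.fst ℝ ℝ ℝ + κ • ContinuousLinearMap.snd ℝ ℝ ℝ) x :=
  hasFDerivAt_fst.add (hasFDerivAt_snd.const_mul κ)

theorem contDiff_comp_helix (κ : ℝ) {u v : ℝ → ℝ} (hu : ∀ s, HasDerivAt u (v s) s)
    (hv : Continuous v) : ContDiff ℝ 1 fun x => u (helix κ x) := by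
  refine (contDiff_one_of_hasDerivAt hu hv).comp ?_
  unfold helix
  fun_prop

theorem fderiv_comp_helix (κ : ℝ) {u v : ℝ → ℝ} (hu : ∀ s, HasDerivAt u (v s) s) (i : Fin 2)
    (x : ℝ × ℝ) :
    fderiv ℝ (fun x => u (helix κ x)) x (dir i) = helixSlope κ i * v (helix κ x) := by
  have h := (hu (helix κ x)).comp_hasFDerivAt x (hasFDerivAt_helix κ x)
  have h' := h.fderiv
  simp only [Function.comp_def] at h'
  rw [h']
  fin_cases i <;> simp [dir, helixSlope, mul_comm]

/-- Since `κ` is a multiple of `2π`, the shift `z ↦ z + 1` moves the phase by whole periods of `u`.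
-/
theorem memH1per_comp_helix {κ : ℝ} (hκ : ∃ N : ℕ, κ = N * (2 * Real.pi)) {u v : ℝ → ℝ}
    (hu : ∀ s, HasDerivAt u (v s) s) (hv : Continuous v) (hp : Function.Periodic u (2 * Real.pi))
    {f : ℝ × ℝ → ℝ} (hf : f =ᵐ[vol] fun x => u (helix κ x)) :
    MemH1per f ∧ ∀ i, wd i f =ᵐ[vol] fun x => helixSlope κ i * v (helix κ x) := by
  obtain ⟨N, rfl⟩ := hκ
  have h := memH1per_of_contDiff (contDiff_comp_helix _ hu hv) (fun θ z => ?_) (fun θ z => ?_) hf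
  · simpa only [fderiv_comp_helix _ hu] using h
  · rw [← hp (helix _ (θ, z))]
    congr 1
    simp only [helix]
    ring
  · rw [← hp.nat_mul N (helix _ (θ, z))]
    congr 1
    simp only [helix]
    ring

theorem integral_comp_helix (κ : ℝ) {U : ℝ → ℝ} (hU : Continuous U)
    (hp : Function.Periodic U (2 * Real.pi)) :
    ∫ x, U (helix κ x) ∂vol = ∫ s in 0..2 * Real.pi, U s := by
  have hint : Integrable (fun x => U (helix κ x)) vol :=
    integrable_vol_of_continuous (hU.comp (continuous_helix κ))
  have hvol : vol = (volume.restrict (Icc 0 (2 * Real.pi))).prod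
      (volume.restrict (Icc (-1 / 2) (1 / 2))) := by
    rw [Measure.prod_restrict, vol, Omega, Measure.volume_eq_prod]
  rw [hvol] at hint ⊢
  rw [integral_prod_symm _ hint]
  -- At fixed `z` the phase runs over one full period, only shifted by `κz`.
  have inner : ∀ z : ℝ, ∫ θ in Icc 0 (2 * Real.pi), U (helix κ (θ, z)) =
      ∫ s in 0..2 * Real.pi, U s := fun z => by
    rw [integral_Icc_eq_integral_Ioc, ← intervalIntegral.integral_of_le (by positivity)]
    simp only [helix]
    rw [intervalIntegral.integral_comp_add_right, zero_add, add_comm,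
      hp.intervalIntegral_add_eq _ 0, zero_add]
  simp only [inner]
  rw [integral_const]
  simp [measureReal_def]
  norm_num

/-- Helical wrinkles: the axial strain vanishes and the hoop strain is constant. -/
theorem exists_helical_displacement {h lam κ : ℝ} (hκ0 : 0 < κ)
    (hκ : ∃ N : ℕ, κ = N * (2 * Real.pi)) {F F₁ F₂ : ℝ → ℝ}
    (hF : ∀ s, HasDerivAt F (F₁ s) s) (hF₁ : ∀ s, HasDerivAt F₁ (F₂ s) s) (hF₂ : Continuous F₂)
    (pF : Function.Periodic F (2 * Real.pi)) (pF₁ : Function.Periodic F₁ (2 * Real.pi))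
    (pF₂ : Function.Periodic F₂ (2 * Real.pi)) (hF0 : ∀ s, 0 ≤ F s)
    (hmean : ∫ s in 0..2 * Real.pi, F₁ s ^ 2 = 4 * Real.pi * lam / κ ^ 2) :
    ∃ φ ∈ A lam, FS h φ ≤ ENNReal.ofReal
      (2 * Real.pi * ((2 * Real.pi)⁻¹ * (∫ s in 0..2 * Real.pi, F s) + lam / κ ^ 2) ^ 2 +
        h ^ 2 * (1 + κ ^ 2) ^ 2 * ∫ s in 0..2 * Real.pi, F₂ s ^ 2) := by
  have hpi : Real.pi ≠ 0 := Real.pi_ne_zero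
  have cF : Continuous F := continuous_iff_continuousAt.2 fun s => (hF s).continuousAt
  have cF₁ : Continuous F₁ := continuous_iff_continuousAt.2 fun s => (hF₁ s).continuousAt
  set e : ℝ := (2 * Real.pi)⁻¹ * (∫ s in 0..2 * Real.pi, F s) + lam / κ ^ 2 with he
  have ii : ∀ {u : ℝ → ℝ}, Continuous u → IntervalIntegrable u volume 0 (2 * Real.pi) :=
    fun hu => hu.intervalIntegrable _ _
  -- `φ_θ` makes the hoop strain equal to the mean `e` of `F + F₁² / 2`, the least value its square
  -- integral can have for this `F`.
  obtain ⟨G, pG, hG⟩ := exists_periodic_primitive (v := fun s => e - F s - 1 / 2 * F₁ s ^ 2)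
    (T := 2 * Real.pi) (by fun_prop) (fun s => by simp only [pF s, pF₁ s]) (by
      rw [intervalIntegral.integral_sub (ii (by fun_prop)) (ii (by fun_prop)),
        intervalIntegral.integral_sub (ii (by fun_prop)) (ii cF),
        intervalIntegral.integral_const_mul, hmean, intervalIntegral.integral_const, he]
      simp only [smul_eq_mul]
      field_simp
      ring)
  -- `φ_z = H - λz` cancels the axial strain; the value prescribed in `hmean` is the solvability
  -- condition.
  obtain ⟨H, pH, hH⟩ := exists_periodic_primitive
    (v := fun s => κ⁻¹ * (lam - 1 / 2 * κ ^ 2 * F₁ s ^ 2))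
    (T := 2 * Real.pi) (by fun_prop) (fun s => by simp only [pF₁ s]) (by
      rw [intervalIntegral.integral_const_mul,
        intervalIntegral.integral_sub (ii (by fun_prop)) (ii (by fun_prop)),
        intervalIntegral.integral_const_mul, hmean, intervalIntegral.integral_const]
      simp only [smul_eq_mul]
      field_simp
      ring)
  have r0 := memH1per_comp_helix hκ hF cF₁ pF (EventuallyEq.refl _ _)
  have r1 : ∀ i, MemH1per (wd i fun x => F (helix κ x)) ∧
      ∀ j, wd j (wd i fun x => F (helix κ x)) =ᵐ[vol]
        fun x => helixSlope κ j * (helixSlope κ i * F₂ (helix κ x)) := fun i =>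
    memH1per_comp_helix hκ (u := fun s => helixSlope κ i * F₁ s)
      (fun s => (hF₁ s).const_mul _) (by fun_prop) (fun s => by simp only [pF₁ s]) (r0.2 i)
  have rθ := memH1per_comp_helix hκ hG (by fun_prop) pG (EventuallyEq.refl _ _)
  have rz := memH1per_comp_helix hκ hH (by fun_prop) pH (EventuallyEq.refl _ _)
  have rz' : wd 1 (fun x : ℝ × ℝ => H (helix κ x) - lam * x.2) =ᵐ[vol]
      fun x => -(1 / 2 * κ ^ 2 * F₁ (helix κ x) ^ 2) := by
    have hc := contDiff_comp_helix κ hH (by fun_prop)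
    have := (HasWeakDeriv.of_contDiff 1
      (hc.sub (by fun_prop : ContDiff ℝ 1 fun x : ℝ × ℝ => lam * x.2))
      (EventuallyEq.refl _ _)).wd_ae_eq.2
    refine this.trans (Eventually.of_forall fun x => ?_)
    simp only
    rw [fderiv_fun_sub (hc.differentiable one_ne_zero x) (by fun_prop), sub_apply,
      fderiv_comp_helix κ hH, (hasFDerivAt_snd.const_mul lam).fderiv]
    simp only [helixSlope, dir, Matrix.cons_val_one, Matrix.cons_val_fin_one, smul_apply,
      ContinuousLinearMap.coe_snd', smul_eq_mul]
    field_simp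
    ring
  set φ : Displacement :=
    ⟨fun x => F (helix κ x), ![fun x => G (helix κ x), fun x => H (helix κ x) - lam * x.2]⟩ with hφ
  refine ⟨φ, ⟨⟨r0.1, fun i => (r1 i).1⟩, rθ.1, ?_, ?_, fun _ => le_top, fun _ _ => le_top⟩, ?_⟩
  · have : (fun x : ℝ × ℝ => φ.cyl 1 x + lam * x.2) = fun x => H (helix κ x) := by
      funext x
      simp [hφ]
    rw [this]
    exact rz.1
  · exact Eventually.of_forall fun x => by
      rw [sub_self]
      exact hF0 _
  · have hc : Continuous fun x => F₂ (helix κ x) := hF₂.comp (continuous_helix κ)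
    have hae : ∀ᵐ x ∂vol, strain φ 0 0 x ^ 2 + strain φ 1 1 x ^ 2 + h ^ 2 * hessSq φ.rad x =
        e ^ 2 + h ^ 2 * (1 + κ ^ 2) ^ 2 * F₂ (helix κ x) ^ 2 := by
      filter_upwards [r0.2 0, r0.2 1, (r1 0).2 0, (r1 0).2 1, (r1 1).2 0, (r1 1).2 1, rθ.2 0, rz']
        with x a0 a1 b00 b01 b10 b11 c0 c1
      have hs0 : strain φ 0 0 x = e := by
        simp only [strain, hφ, and_self, if_true, Matrix.cons_val_zero, a0, c0, helixSlope]
        ring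
      have hs1 : strain φ 1 1 x = 0 := by
        simp only [strain, hφ, Matrix.cons_val_one, Matrix.cons_val_fin_one, a1, c1, helixSlope]
        simp
        ring
      have hh : hessSq φ.rad x = (1 + κ ^ 2) ^ 2 * F₂ (helix κ x) ^ 2 := by
        simp only [hessSq, hφ, Fin.sum_univ_two, b00, b01, b10, b11, helixSlope,
          Matrix.cons_val_zero, Matrix.cons_val_one, Matrix.cons_val_fin_one]
        ring
      rw [hs0, hs1, hh]
      ring
    have hint : Integrable (fun x => h ^ 2 * (1 + κ ^ 2) ^ 2 * F₂ (helix κ x) ^ 2) vol :=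
      integrable_vol_of_continuous ((hc.pow 2).const_mul _)
    have hFS : FS h φ = ∫⁻ x, ENNReal.ofReal
        (e ^ 2 + h ^ 2 * (1 + κ ^ 2) ^ 2 * F₂ (helix κ x) ^ 2) ∂vol :=
      lintegral_congr_ae (hae.mono fun x hx => by simp only [hx])
    have hint' : Integrable
        (fun x => e ^ 2 + h ^ 2 * (1 + κ ^ 2) ^ 2 * F₂ (helix κ x) ^ 2) vol :=
      (integrable_const _).add hint
    have hnn : ∀ x, 0 ≤ e ^ 2 + h ^ 2 * (1 + κ ^ 2) ^ 2 * F₂ (helix κ x) ^ 2 := fun x => by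
      positivity
    rw [hFS, ← ofReal_integral_eq_lintegral_ofReal hint' (Eventually.of_forall hnn),
      integral_add (integrable_const _) hint, integral_const, vol_real_univ, smul_eq_mul,
      integral_const_mul, integral_comp_helix κ (U := fun s => F₂ s ^ 2) (by fun_prop)
        (fun s => by simp only [pF₂ s])]

/-- The upper bound `(hλ)^{12/11}` for the minimum energy, written in terms of
`x = (hλ)^{1/11}` and `r = λ^{1/2}`. -/
theorem exists_displacement_FS_le {h x r : ℝ} (hx : 0 < x) (hx1 : x ≤ 1) (hr : 0 < r)
    (hxr : x ^ 3 ≤ r) (hh : h * r ^ 2 = x ^ 11) :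
    ∃ φ ∈ A (r ^ 2), FS h φ ≤ ENNReal.ofReal (40000 * x ^ 12) := by
  have ceil : ∀ y : ℝ, 1 ≤ y → ∃ n : ℕ, 1 ≤ n ∧ y ≤ n ∧ (n : ℝ) ≤ 2 * y := fun y hy =>
    ⟨⌈y⌉₊, Nat.one_le_ceil_iff.2 (by linarith), Nat.le_ceil y, by
      have := Nat.ceil_lt_add_one (zero_le_one.trans hy)
      linarith⟩
  -- Balance of energies: stretching is of order `(λ/κ²) K⁻³ + (λ/κ²)²` and bending of order `h² λ
  -- κ² K²`. With `κ ~ r / x³` and `K ~ x⁻²` every term is of order `x¹²`.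
  obtain ⟨N, hN1, hN, hN'⟩ := ceil (r / x ^ 3) ((one_le_div (by positivity)).2 hxr)
  obtain ⟨K, hK1, hK, hK'⟩ := ceil (1 / x ^ 2)
    ((one_le_div (by positivity)).2 (pow_le_one₀ hx.le hx1))
  have hpi3 := Real.pi_gt_three
  have hpi4 := Real.pi_lt_d2
  have hN0 : (0 : ℝ) < N := by exact_mod_cast hN1
  have hK0 : (0 : ℝ) < K := by exact_mod_cast hK1
  set κ : ℝ := N * (2 * Real.pi) with hκ
  have hκ0 : 0 < κ := by positivity
  have hκN : 6 * (N : ℝ) ≤ κ := by rw [hκ]; nlinarith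
  have hκN' : κ ≤ 7 * (N : ℝ) := by rw [hκ]; nlinarith
  obtain ⟨F, F₁, F₂, hF, hF₁, cF₂, pF, pF₁, pF₂, hF0, hmean, hbend, hmass⟩ :=
    exists_periodic_bump hK1 (μ := 4 * Real.pi * r ^ 2 / κ ^ 2) (by positivity)
  obtain ⟨φ, hφ, hFS⟩ := exists_helical_displacement (h := h) (lam := r ^ 2) hκ0 ⟨N, hκ⟩ hF hF₁
    cF₂ pF pF₁ pF₂ hF0 hmean
  refine ⟨φ, hφ, hFS.trans (ENNReal.ofReal_le_ofReal ?_)⟩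
  set I := ∫ s in 0..2 * Real.pi, F s
  set J := ∫ s in 0..2 * Real.pi, F₂ s ^ 2
  have hrκ : r ^ 2 / κ ^ 2 ≤ x ^ 6 / 36 := by
    have h1 : r ≤ N * x ^ 3 := (div_le_iff₀ (by positivity)).1 hN
    rw [div_le_div_iff₀ (by positivity) (by norm_num)]
    calc r ^ 2 * 36 ≤ (N * x ^ 3) ^ 2 * 36 := by gcongr
      _ = x ^ 6 * (6 * N) ^ 2 := by ring
      _ ≤ x ^ 6 * κ ^ 2 := by gcongr
  have hK3 : 1 / (K : ℝ) ^ 3 ≤ x ^ 6 := by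
    have h1 : 1 ≤ K * x ^ 2 := (div_le_iff₀ (by positivity)).1 hK
    rw [div_le_iff₀ (by positivity)]
    calc (1 : ℝ) ≤ (K * x ^ 2) ^ 3 := one_le_pow₀ h1
      _ = x ^ 6 * K ^ 3 := by ring
  have hI : ((2 * Real.pi)⁻¹ * I) ^ 2 ≤ 8 * (x ^ 6 / 36) * x ^ 6 := by
    calc ((2 * Real.pi)⁻¹ * I) ^ 2 = (2 * Real.pi)⁻¹ ^ 2 * I ^ 2 := by ring
      _ ≤ (2 * Real.pi)⁻¹ ^ 2 * (8 * Real.pi * (4 * Real.pi * r ^ 2 / κ ^ 2) / K ^ 3) := by gcongr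
      _ = 8 * (r ^ 2 / κ ^ 2) * (1 / K ^ 3) := by field_simp; ring
      _ ≤ _ := by gcongr
  have hq : (r ^ 2 / κ ^ 2) ^ 2 ≤ (x ^ 6 / 36) ^ 2 := by gcongr
  have he : ((2 * Real.pi)⁻¹ * I + r ^ 2 / κ ^ 2) ^ 2 ≤ x ^ 12 := by
    have h1 := add_sq_le (a := (2 * Real.pi)⁻¹ * I) (b := r ^ 2 / κ ^ 2)
    have h2 : 0 < x ^ 12 := by positivity
    linarith
  have hb : h ^ 2 * (1 + κ ^ 2) ^ 2 * J ≤ 39600 * x ^ 12 := by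
    have h1 : (N : ℝ) * x ^ 3 ≤ 2 * r := by
      have := mul_le_mul_of_nonneg_right hN' (by positivity : 0 ≤ x ^ 3)
      rwa [mul_assoc 2, div_mul_cancel₀ _ (by positivity)] at this
    have h2 : (K : ℝ) * x ^ 2 ≤ 2 := by
      have := mul_le_mul_of_nonneg_right hK' (by positivity : 0 ≤ x ^ 2)
      rwa [mul_assoc 2, div_mul_cancel₀ _ (by positivity), mul_one] at this
    have hκ1 : 1 ≤ κ ^ 2 := by
      have : (1 : ℝ) ≤ N := by exact_mod_cast hN1
      nlinarith
    have hJ0 : 0 ≤ J := intervalIntegral.integral_nonneg (by positivity) fun _ _ => sq_nonneg _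
    have h3 : h ^ 2 * (1 + κ ^ 2) ^ 2 * J ≤ 16 * Real.pi * (h * r * κ * K) ^ 2 := by
      calc h ^ 2 * (1 + κ ^ 2) ^ 2 * J
          ≤ h ^ 2 * (κ ^ 2 + κ ^ 2) ^ 2 * (K ^ 2 * (4 * Real.pi * r ^ 2 / κ ^ 2)) := by gcongr
        _ = _ := by field_simp; ring
    -- The factor `x ^ 10` pairs with `N` and `K` to form `N x³` and `K x²`, avoiding division.
    have h4 : (h * r * κ * K) ^ 2 * x ^ 10 ≤ 784 * x ^ 12 * x ^ 10 := by
      calc (h * r * κ * K) ^ 2 * x ^ 10 ≤ (h * r * (7 * N) * K) ^ 2 * x ^ 10 := by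
            rw [mul_pow, mul_pow, mul_pow (h * r * (7 * N)), mul_pow (h * r)]
            gcongr
        _ = 49 * (h * r) ^ 2 * (N * x ^ 3) ^ 2 * (K * x ^ 2) ^ 2 := by ring
        _ ≤ 49 * (h * r) ^ 2 * (2 * r) ^ 2 * 2 ^ 2 := by gcongr
        _ = 784 * (h * r ^ 2) ^ 2 := by ring
        _ = _ := by rw [hh]; ring
    have h5 := le_of_mul_le_mul_right h4 (by positivity)
    calc _ ≤ 16 * Real.pi * (784 * x ^ 12) := h3.trans (by gcongr)
      _ ≤ 16 * 3.15 * (784 * x ^ 12) := by gcongr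
      _ ≤ _ := by
        have : 0 < x ^ 12 := by positivity
        linarith
  have hx12 : 0 < x ^ 12 := by positivity
  have : 2 * Real.pi * ((2 * Real.pi)⁻¹ * I + r ^ 2 / κ ^ 2) ^ 2 ≤ 2 * 3.15 * x ^ 12 := by gcongr
  linarith

/-! ### Slopes of minimizers -/

theorem ae_abs_wd_le {f : ℝ × ℝ → ℝ} (hm : eLpNorm (grad f) ⊤ vol ≠ ⊤) (i : Fin 2) :
    ∀ᵐ x ∂vol, |wd i f x| ≤ (eLpNorm (grad f) ⊤ vol).toReal := by
  rw [eLpNorm_exponent_top] at hm ⊢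
  filter_upwards [ae_le_eLpNormEssSup (f := grad f) (μ := vol)] with x hx
  have h1 : ‖grad f x‖ ≤ (eLpNormEssSup (grad f) vol).toReal := by
    have := ENNReal.toReal_mono hm hx
    rwa [toReal_enorm] at this
  exact (PiLp.norm_apply_le (grad f x) i).trans h1

/-- Minimizers have slopes at least of order `x⁻¹ r`, where `x = (hλ)^{1/11}`, `r = λ^{1/2}`. -/
theorem le_slope_of_isMinOn {h x r : ℝ} {φ : Displacement} (hh0 : 0 < h) (hx : 0 < x)
    (hx1 : x ≤ 1) (hr : 0 < r) (hxr : 80000 * x ^ 12 ≤ r ^ 4) (hh : h * r ^ 2 = x ^ 11)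
    (hφ : φ ∈ A (r ^ 2)) (hmin : IsMinOn (FS h) (A (r ^ 2)) φ) :
    ENNReal.ofReal (x⁻¹ * r) ≤ ENNReal.ofReal 240000 * eLpNorm (grad φ.rad) ⊤ vol := by
  rcases eq_or_ne (eLpNorm (grad φ.rad) ⊤ vol) ⊤ with htop | hfin
  · rw [htop, ENNReal.mul_top (by simp)]
    exact le_top
  set m := (eLpNorm (grad φ.rad) ⊤ vol).toReal with hm
  have hx3 : x ^ 3 ≤ r := by
    refine le_of_pow_le_pow_left₀ (n := 4) (by norm_num) hr.le ?_
    have : 0 < x ^ 12 := by positivity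
    calc (x ^ 3) ^ 4 = x ^ 12 := by ring
      _ ≤ r ^ 4 := by linarith
  obtain ⟨χ, hχ, hFS⟩ := exists_displacement_FS_le hx hx1 hr hx3 hh
  have key := cube_mul_sq_le hh0 (by positivity : 0 < r ^ 2)
    (by positivity : 0 < 40000 * x ^ 12) (by nlinarith [Real.pi_gt_three, sq_nonneg (r ^ 2)]) hφ
    ((hmin hχ).trans hFS) (ae_abs_wd_le hfin 1)
  rw [← hm] at key
  have hm0 : 0 ≤ m := ENNReal.toReal_nonneg
  -- Here `240000` is a rounding up of the square root of `32 * 40000 ^ 2`.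
  have h1 : r ^ 2 ≤ (240000 * (m * x)) ^ 2 := by
    have e1 : (r ^ 2) ^ 3 * h ^ 2 = r ^ 2 * x ^ 22 := by
      calc _ = r ^ 2 * (h * r ^ 2) ^ 2 := by ring
        _ = _ := by rw [hh]; ring
    rw [e1] at key
    have h2 : r ^ 2 * x ^ 22 ≤ (32 * 40000 ^ 2 * (m * x) ^ 2) * x ^ 22 := by
      refine key.trans (le_of_eq (by ring))
    have h3 := le_of_mul_le_mul_right h2 (by positivity)
    nlinarith [sq_nonneg (m * x)]
  have h2 : r ≤ 240000 * (m * x) := le_of_sq_le_sq h1 (by positivity)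
  rw [← ENNReal.ofReal_toReal hfin, ← hm, ← ENNReal.ofReal_mul (by norm_num)]
  refine ENNReal.ofReal_le_ofReal ?_
  rw [inv_mul_le_iff₀ hx]
  linarith

end FreeShear

theorem mainTheorem9 :
    ∃ C : ℝ, 0 < C ∧
      ∀ (h lam : ℝ → ℝ) (φ : ℝ → FreeShear.Displacement),
        (∀ α : ℝ, 0 < α → h α ∈ Set.Ioc (0 : ℝ) (1 / 2) ∧ lam α ∈ Set.Ioc (0 : ℝ) (1 / 2)) →
        h =o[Filter.atTop] (fun α => lam α ^ (5 / 6 : ℝ)) →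
        (∀ α : ℝ, 0 < α → φ α ∈ FreeShear.A (lam α) ∧
          IsMinOn (FreeShear.FS (h α)) (FreeShear.A (lam α)) (φ α)) →
        ∀ᶠ α in Filter.atTop,
          ENNReal.ofReal (h α ^ (-1 / 11 : ℝ) * lam α ^ (9 / 22 : ℝ)) ≤
            ENNReal.ofReal C *
              MeasureTheory.eLpNorm (FreeShear.grad (φ α).rad) ⊤ FreeShear.vol := by
  refine ⟨240000, by norm_num, fun h lam φ hbd ho hφ => ?_⟩
  filter_upwards [ho.def (by norm_num : (0 : ℝ) < 1 / 80000), Filter.eventually_gt_atTop 0]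
    with α hα hα0
  obtain ⟨⟨hh0, hh1⟩, hl0, hl1⟩ := hbd α hα0
  obtain ⟨hA, hmin⟩ := hφ α hα0
  generalize h α = H at *
  generalize lam α = L at *
  have hHL : 0 < H * L := by positivity
  have hr2 : (L ^ (1 / 2 : ℝ)) ^ 2 = L := by
    rw [← Real.rpow_natCast, ← Real.rpow_mul hl0.le]
    norm_num
  have hx11 : ((H * L) ^ (1 / 11 : ℝ)) ^ 11 = H * L := by
    rw [← Real.rpow_natCast, ← Real.rpow_mul hHL.le]
    norm_num
  -- With `E = 40000 x¹²` this gives `2 E ≤ λ²`. Raising `h ≤ λ^{5/6} / 80000`, multiplied by `λ`,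
  -- to the power `12/11` yields it.
  have hx12 : 80000 * ((H * L) ^ (1 / 11 : ℝ)) ^ 12 ≤ (L ^ (1 / 2 : ℝ)) ^ 4 := by
    rw [Real.norm_of_nonneg hh0.le, Real.norm_of_nonneg (by positivity)] at hα
    have e1 : ((H * L) ^ (1 / 11 : ℝ)) ^ 12 = (H * L) ^ (12 / 11 : ℝ) := by
      rw [← Real.rpow_natCast, ← Real.rpow_mul hHL.le]
      norm_num
    have e2 : (L ^ (1 / 2 : ℝ)) ^ 4 = L ^ (2 : ℝ) := by
      rw [← Real.rpow_natCast, ← Real.rpow_mul hl0.le]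
      norm_num
    have e3 : L ^ (5 / 6 : ℝ) * L = L ^ (11 / 6 : ℝ) := by
      rw [← Real.rpow_add_one hl0.ne']
      norm_num
    have e4 : (1 / 80000 : ℝ) ^ (12 / 11 : ℝ) ≤ 1 / 80000 := by
      refine (Real.rpow_le_rpow_of_exponent_ge (by norm_num) (by norm_num)
        (by norm_num : (1 : ℝ) ≤ 12 / 11)).trans_eq (Real.rpow_one _)
    rw [e1, e2]
    calc 80000 * (H * L) ^ (12 / 11 : ℝ)
        ≤ 80000 * (1 / 80000 * L ^ (5 / 6 : ℝ) * L) ^ (12 / 11 : ℝ) := by gcongr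
      _ = 80000 * ((1 / 80000 : ℝ) ^ (12 / 11 : ℝ) * L ^ (2 : ℝ)) := by
          rw [mul_assoc, e3, Real.mul_rpow (by norm_num) (by positivity), ← Real.rpow_mul hl0.le]
          norm_num
      _ ≤ 80000 * (1 / 80000 * L ^ (2 : ℝ)) := by gcongr
      _ = L ^ (2 : ℝ) := by ring
  have hx1 : (H * L) ^ (1 / 11 : ℝ) ≤ 1 :=
    Real.rpow_le_one hHL.le (by nlinarith) (by norm_num)
  have key := FreeShear.le_slope_of_isMinOn (φ := φ α) hh0
    (Real.rpow_pos_of_pos hHL _) hx1 (Real.rpow_pos_of_pos hl0 (1 / 2)) hx12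
    (by rw [hr2, hx11]) (by rwa [hr2]) (by rwa [hr2])
  -- The exponents of `λ` add up: `-1/11 + 1/2 = 9/22`.
  convert key using 2
  rw [← Real.rpow_neg hHL.le, Real.mul_rpow hh0.le hl0.le, mul_assoc, ← Real.rpow_add hl0]
  norm_num
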